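/- For real numbers $p,\lambda>0$ let \[E_{p,\lambda}=\{(x,y,z)\in\mathbb{C}^3 : (|x|^{2p}+|y|^2)^{1/\lambda}+|z|^2<1\},\] and write $(z_1,z_2,z_3)=(x,y,z)$. Let $K(z,w)=\sum_j e_j(z)\overline{e_j(w)}$, for an orthonormal basis $(e_j)$ of the Hilbert space of square-integrable holomorphic functions on $E_{p,\lambda}$ (with respect to Lebesgue measure), be the Bergman kernel of $E_{p,\lambda}$, and let \[g_{i\overline{j}}=\frac{\partial^2\log K(z,z)}{\partial z_i\,\partial\overline{z_j}},\qquad i,j=1,2,3,\] be the components of its Bergman metric $g_B$. Then $g_B$ is a Kähler–Einstein metric on $E_{p,\lambda}$, that is, a Kähler metric whose Ricci curvature satisfies $\operatorname{Ric}(g_B)=c\,g_B$ on $E_{p,\lambda}$ for some constant $c\in\mathbb{R}$, if and only if $\lambda=p=1$. Here $\operatorname{Ric}_{k\overline{l}}=\sum_{i,j}g^{i\overline{j}}R_{i\overline{j}k\overline{l}}$, where $(g^{i\overline j})$ is the inverse metric and \[R_{i\overline{j}k\overline{l}}=-\frac{\partial^2 g_{i\overline{j}}}{\partial z_k\,\partial\overline{z_l}}+\sum_{p',q'}g^{q'\overline{p'}}\,\frac{\partial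 g_{i\overline{p'}}}{\partial z_k}\,\frac{\partial g_{q'\overline{j}}}{\partial\overline{z_l}}.\] -/

import Mathlib

open MeasureTheory
open scoped ContDiff ComplexOrder ComplexConjugate

noncomputable section

/-- The Bergman space of `Ω ⊆ ℂⁿ`: the square-integrable functions on `Ω` (with respect to
Lebesgue measure) that are holomorphic, that is, classes in `L²(Ω)` with a holomorphic
representative. -/
def bergmanSpace {n : ℕ} (Ω : Set (Fin n → ℂ)) :
    Submodule ℂ (Lp ℂ 2 (volume.restrict Ω)) where
  carrier := {f | ∃ F : (Fin n → ℂ) → ℂ, DifferentiableOn ℂ F Ω ∧ f =ᵐ[volume.restrict Ω] F}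
  add_mem' := by
    rintro f g ⟨F, hF, hfF⟩ ⟨G, hG, hgG⟩
    exact ⟨F + G, hF.add hG, (Lp.coeFn_add f g).trans (hfF.add hgG)⟩
  zero_mem' := ⟨0, differentiableOn_const 0, Lp.coeFn_zero ℂ 2 _⟩
  smul_mem' := by
    rintro c f ⟨F, hF, hfF⟩
    exact ⟨c • F, hF.const_smul c, (Lp.coeFn_smul c f).trans (hfF.const_smul c)⟩

/-- The holomorphic function on `Ω` represented by an element of the Bergman space. For open `Ω`
its values on `Ω` are uniquely determined. -/
def holoRep {n : ℕ} {Ω : Set (Fin n → ℂ)} (f : bergmanSpace Ω) : (Fin n → ℂ) → ℂ :=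
  Classical.choose f.2

theorem holoRep_spec {n : ℕ} {Ω : Set (Fin n → ℂ)} (f : bergmanSpace Ω) :
    DifferentiableOn ℂ (holoRep f) Ω ∧
      (f : Lp ℂ 2 (volume.restrict Ω)) =ᵐ[volume.restrict Ω] holoRep f :=
  Classical.choose_spec f.2

/-- `S` is an orthonormal (Hilbert) basis of the Bergman space. -/
def IsBergmanBasis {n : ℕ} (Ω : Set (Fin n → ℂ)) (S : Set (bergmanSpace Ω)) : Prop :=
  Orthonormal ℂ (fun e : S => (e : bergmanSpace Ω)) ∧
    (Submodule.span ℂ S).topologicalClosure = ⊤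

theorem exists_isBergmanBasis {n : ℕ} (Ω : Set (Fin n → ℂ)) :
    ∃ S : Set (bergmanSpace Ω), IsBergmanBasis Ω S := by
  have : Fact ((2 : ENNReal) ≠ ⊤) := ⟨by simp⟩
  have : SecondCountableTopology (Lp ℂ 2 (volume.restrict Ω)) := inferInstance
  have : SecondCountableTopology (bergmanSpace Ω) :=
    TopologicalSpace.Subtype.secondCountableTopology _
  let d : ℕ → bergmanSpace Ω := TopologicalSpace.denseSeq _
  let u : ℕ → bergmanSpace Ω := InnerProductSpace.gramSchmidtNormed ℂ d
  have hu : Orthonormal ℂ fun i : {i | u i ≠ 0} => u i :=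
    InnerProductSpace.gramSchmidtNormed_orthonormal' d
  refine ⟨Set.range fun i : {i | u i ≠ 0} => u i, hu.toSubtypeRange, ?_⟩
  have h1 : Submodule.span ℂ (Set.range fun i : {i | u i ≠ 0} => u i)
      = Submodule.span ℂ (Set.range d) := by
    rw [← InnerProductSpace.span_gramSchmidt ℂ d, ← InnerProductSpace.span_gramSchmidtNormed_range]
    apply le_antisymm
    · apply Submodule.span_mono
      rintro _ ⟨i, rfl⟩
      exact ⟨i, rfl⟩
    · rw [Submodule.span_le]
      rintro _ ⟨i, rfl⟩
      by_cases hi : u i = 0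
      · change u i ∈ _
        rw [hi]
        exact Submodule.zero_mem _
      · exact Submodule.subset_span ⟨⟨i, hi⟩, rfl⟩
  rw [h1, ← Submodule.dense_iff_topologicalClosure_eq_top]
  exact (TopologicalSpace.denseRange_denseSeq _).mono Submodule.subset_span

/-- An orthonormal basis of the Bergman space. -/
def bergmanBasis {n : ℕ} (Ω : Set (Fin n → ℂ)) : Set (bergmanSpace Ω) :=
  Classical.choose (exists_isBergmanBasis Ω)

/-- The Bergman kernel `K(z, w) = ∑ⱼ eⱼ(z) conj (eⱼ(w))` of `Ω`, for an orthonormal basis `(eⱼ)`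
of the Bergman space (the sum does not depend on the basis). -/
def bergmanKernel {n : ℕ} (Ω : Set (Fin n → ℂ)) (z w : Fin n → ℂ) : ℂ :=
  ∑' e : bergmanBasis Ω,
    holoRep e.1 z * conj (holoRep e.1 w)

/-- The Wirtinger derivative `∂f/∂zᵢ = (∂f/∂xᵢ - √-1 ∂f/∂yᵢ) / 2`. -/
def wirtinger {n : ℕ} (i : Fin n) (f : (Fin n → ℂ) → ℂ) (z : Fin n → ℂ) : ℂ :=
  (fderiv ℝ f z (Pi.single i 1) - Complex.I * fderiv ℝ f z (Pi.single i Complex.I)) / 2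

/-- The Wirtinger derivative `∂f/∂z̄ᵢ = (∂f/∂xᵢ + √-1 ∂f/∂yᵢ) / 2`. -/
def wirtingerBar {n : ℕ} (i : Fin n) (f : (Fin n → ℂ) → ℂ) (z : Fin n → ℂ) : ℂ :=
  (fderiv ℝ f z (Pi.single i 1) + Complex.I * fderiv ℝ f z (Pi.single i Complex.I)) / 2

/-- The components `g_{i j̄} = ∂² log K(z, z) / ∂zᵢ ∂z̄ⱼ` of the Bergman metric of `Ω`. -/
def bergmanMetric {n : ℕ} (Ω : Set (Fin n → ℂ)) (z : Fin n → ℂ) : Matrix (Fin n) (Fin n) ℂ :=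
  Matrix.of fun i j =>
    wirtinger i (wirtingerBar j fun w => (Real.log (bergmanKernel Ω w w).re : ℂ)) z

/-- The matrix field `g = (g_{i j̄})` is (the component matrix of) a Kähler metric on the open set
`Ω`: smooth, Hermitian positive definite, with closed fundamental form. -/
structure IsKahlerMetric {n : ℕ} (Ω : Set (Fin n → ℂ))
    (g : (Fin n → ℂ) → Matrix (Fin n) (Fin n) ℂ) : Prop where
  smooth : ∀ i j, ContDiffOn ℝ ∞ (fun z => g z i j) Ω
  posDef : ∀ z ∈ Ω, (g z).PosDef
  closed : ∀ z ∈ Ω, ∀ i j k,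
    wirtinger k (fun w => g w i j) z = wirtinger i (fun w => g w k j) z

/-- The components of the Chern curvature tensor,
`R_{i j̄ k l̄} = - ∂² g_{i j̄} / ∂z_k ∂z̄_l + ∑_{p, q} g^{q p̄} (∂ g_{i p̄} / ∂z_k) (∂ g_{q j̄} / ∂z̄_l)`,
where `g^{q p̄}` is the `(p, q)` entry of the inverse of the matrix `(g_{i j̄})`. -/
def chernCurvature {n : ℕ} (g : (Fin n → ℂ) → Matrix (Fin n) (Fin n) ℂ) (i j k l : Fin n)
    (z : Fin n → ℂ) : ℂ :=
  -wirtinger k (wirtingerBar l fun w => g w i j) z +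
    ∑ p, ∑ q, (g z)⁻¹ p q *
      wirtinger k (fun w => g w i p) z * wirtingerBar l (fun w => g w q j) z

/-- The Ricci curvature `Ric_{k l̄} = ∑_{i, j} g^{i j̄} R_{i j̄ k l̄}`. -/
def ricciCurvature {n : ℕ} (g : (Fin n → ℂ) → Matrix (Fin n) (Fin n) ℂ) (z : Fin n → ℂ) :
    Matrix (Fin n) (Fin n) ℂ :=
  Matrix.of fun k l => ∑ i, ∑ j, (g z)⁻¹ j i * chernCurvature g i j k l z

/-- A Kähler–Einstein metric on `Ω`: a Kähler metric whose Ricci curvature is a constant real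
multiple of the metric. -/
def IsKahlerEinstein {n : ℕ} (Ω : Set (Fin n → ℂ))
    (g : (Fin n → ℂ) → Matrix (Fin n) (Fin n) ℂ) : Prop :=
  IsKahlerMetric Ω g ∧ ∃ c : ℝ, ∀ z ∈ Ω, ricciCurvature g z = (c : ℂ) • g z

/-- The domain `E_{p,λ} = {(x, y, z) ∈ ℂ³ : (|x|^{2p} + |y|²)^{1/λ} + |z|² < 1}`. -/
def domainE (p lam : ℝ) : Set (Fin 3 → ℂ) :=
  {v | (‖v 0‖ ^ (2 * p) + ‖v 1‖ ^ 2) ^ (1 / lam) + ‖v 2‖ ^ 2 < 1}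

end

/-! ### Wirtinger calculus -/

section Wirtinger

variable {n : ℕ} {f g : (Fin n → ℂ) → ℂ} {z : Fin n → ℂ}

/-! The domain is a bounded complete Reinhardt domain, so monomials are orthogonal in its Bergman
space and every holomorphic function on it is a single power series. On the diagonal the kernel is
therefore `∑ |z^m|² / ‖z^m‖²` (`IsBoundedReinhardt.bergmanKernel_self`), and the norms `‖z^m‖²` are
products of beta integrals (`monomialNormSq_domainE`). Thus `log K` is a function `L` of the
variables `rᵢ = |zᵢ|²`, real analytic near the origin.

Necessity uses the Einstein equation at the origin alone. By the torus symmetry the metric there is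
diagonal with entries `∂ᵢL(0)`, its first derivatives vanish, and the diagonal Ricci entries involve
only first and second derivatives of `L` (`ricciCurvature_zero`). So the equation becomes a relation
between kernel coefficients of degree at most two (`IsBoundedReinhardt.einstein_zero`). The
`z`-component forces `c = -1` for all `p` and `λ`; the `x`-component is then one rational equation
in `q = 1/p` and `λ` (`einstein_domainE`). Its numerator is `2q` times a combination, with positive
coefficients, of squares weighted by monomials. All these squares vanish only at `q = λ = 1`
(`eq_one_of_einstein`).

Conversely, for `p = λ = 1` the domain is the unit ball. Summing the series gives `K = 6 / π³ · (1 -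
‖z‖²)⁻⁴` by `hasSum_multinomial`, so the Bergman metric is the complex hyperbolic metric `-4 ∂∂̄ log
(1 - ‖z‖²)` (`bergmanMetric_unitBall`), which has constant holomorphic sectional curvature and is
therefore Einstein (`isKahlerEinstein_ballMetric`). -/

theorem wirtinger_congr (i : Fin n) (h : f =ᶠ[nhds z] g) : wirtinger i f z = wirtinger i g z := by
  simp only [wirtinger, h.fderiv_eq]

theorem wirtingerBar_congr (i : Fin n) (h : f =ᶠ[nhds z] g) :
    wirtingerBar i f z = wirtingerBar i g z := by
  simp only [wirtingerBar, h.fderiv_eq]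

theorem wirtinger_add (i : Fin n) (hf : DifferentiableAt ℝ f z) (hg : DifferentiableAt ℝ g z) :
    wirtinger i (fun w => f w + g w) z = wirtinger i f z + wirtinger i g z := by
  simp only [wirtinger, fderiv_fun_add hf hg, add_apply]
  ring

theorem wirtingerBar_add (i : Fin n) (hf : DifferentiableAt ℝ f z) (hg : DifferentiableAt ℝ g z) :
    wirtingerBar i (fun w => f w + g w) z = wirtingerBar i f z + wirtingerBar i g z := by
  simp only [wirtingerBar, fderiv_fun_add hf hg, add_apply]
  ring

theorem wirtinger_mul (i : Fin n) (hf : DifferentiableAt ℝ f z) (hg : DifferentiableAt ℝ g z) :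
    wirtinger i (fun w => f w * g w) z = f z * wirtinger i g z + g z * wirtinger i f z := by
  simp only [wirtinger, fderiv_fun_mul hf hg, add_apply,
    smul_apply, smul_eq_mul]
  ring

theorem wirtingerBar_mul (i : Fin n) (hf : DifferentiableAt ℝ f z) (hg : DifferentiableAt ℝ g z) :
    wirtingerBar i (fun w => f w * g w) z = f z * wirtingerBar i g z + g z * wirtingerBar i f z := by
  simp only [wirtingerBar, fderiv_fun_mul hf hg, add_apply,
    smul_apply, smul_eq_mul]
  ring

theorem wirtinger_const (i : Fin n) (c : ℂ) : wirtinger i (fun _ => c) z = 0 := by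
  simp [wirtinger]

theorem wirtingerBar_const (i : Fin n) (c : ℂ) : wirtingerBar i (fun _ => c) z = 0 := by
  simp [wirtingerBar]

theorem hasFDerivAt_coord (j : Fin n) :
    HasFDerivAt (𝕜 := ℝ) (fun w : Fin n → ℂ => w j) (ContinuousLinearMap.proj j) z :=
  (ContinuousLinearMap.proj (R := ℝ) (φ := fun _ : Fin n => ℂ) j).hasFDerivAt

theorem hasFDerivAt_conj_coord (j : Fin n) :
    HasFDerivAt (𝕜 := ℝ) (fun w : Fin n → ℂ => conj (w j))
      ((Complex.conjCLE : ℂ →L[ℝ] ℂ).comp (ContinuousLinearMap.proj j)) z :=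
  (Complex.conjCLE : ℂ →L[ℝ] ℂ).hasFDerivAt.comp z (hasFDerivAt_coord j)

theorem wirtinger_coord (i j : Fin n) :
    wirtinger i (fun w => w j) z = if i = j then 1 else 0 := by
  rw [wirtinger, (hasFDerivAt_coord j).fderiv]
  rcases eq_or_ne i j with rfl | h
  · simp
  · simp [h, h.symm]

theorem wirtingerBar_coord (i j : Fin n) : wirtingerBar i (fun w => w j) z = 0 := by
  rw [wirtingerBar, (hasFDerivAt_coord j).fderiv]
  rcases eq_or_ne i j with rfl | h
  · simp
  · simp [h.symm]

theorem wirtinger_conj_coord (i j : Fin n) : wirtinger i (fun w => conj (w j)) z = 0 := by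
  rw [wirtinger, (hasFDerivAt_conj_coord j).fderiv]
  rcases eq_or_ne i j with rfl | h
  · simp
  · simp [h.symm]

theorem wirtingerBar_conj_coord (i j : Fin n) :
    wirtingerBar i (fun w => conj (w j)) z = if i = j then 1 else 0 := by
  rw [wirtingerBar, (hasFDerivAt_conj_coord j).fderiv]
  rcases eq_or_ne i j with rfl | h
  · simp
  · simp [h, h.symm]

/-- The vector of squared absolute values of the coordinates. -/
noncomputable def normSqs (z : Fin n → ℂ) : Fin n → ℝ := fun j => Complex.normSq (z j)

/-- The `i`-th partial derivative. -/
noncomputable def partialDeriv (i : Fin n) (G : (Fin n → ℝ) → ℝ) (r : Fin n → ℝ) : ℝ :=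
  fderiv ℝ G r (Pi.single i 1)

theorem contDiff_normSqs : ContDiff ℝ ∞ (normSqs (n := n)) := by
  refine contDiff_pi.2 fun j => ?_
  have h : (fun z : Fin n → ℂ => normSqs z j) = fun z => ‖z j‖ ^ 2 := by
    ext z
    simp [normSqs, Complex.normSq_eq_norm_sq]
  rw [h]
  exact (contDiff_apply ℝ ℂ j).norm_sq ℝ

theorem continuous_normSqs : Continuous (normSqs (n := n)) := contDiff_normSqs.continuous

theorem hasFDerivAt_normSqs (z : Fin n → ℂ) :
    HasFDerivAt (normSqs (n := n)) (ContinuousLinearMap.pi fun j =>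
      (2 * (z j).re) • Complex.reCLM.comp (ContinuousLinearMap.proj (R := ℝ) j) +
      (2 * (z j).im) • Complex.imCLM.comp (ContinuousLinearMap.proj (R := ℝ) j)) z := by
  refine hasFDerivAt_pi.2 fun j => ?_
  have h1 := Complex.reCLM.hasFDerivAt.comp z (hasFDerivAt_coord (z := z) j)
  have h2 := Complex.imCLM.hasFDerivAt.comp z (hasFDerivAt_coord (z := z) j)
  have h := (h1.mul h1).add (h2.mul h2)
  refine (h.congr_fderiv ?_)
  ext v
  simp
  ring

theorem fderiv_ofReal_comp_normSqs {G : (Fin n → ℝ) → ℝ} (hG : DifferentiableAt ℝ G (normSqs z))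
    (i : Fin n) (c : ℂ) :
    fderiv ℝ (fun w => (G (normSqs w) : ℂ)) z (Pi.single i c)
      = ((2 * (z i).re * c.re + 2 * (z i).im * c.im) * partialDeriv i G (normSqs z) : ℝ) := by
  have h := Complex.ofRealCLM.hasFDerivAt.comp z
    (hG.hasFDerivAt.comp z (hasFDerivAt_normSqs z))
  have h' : HasFDerivAt (fun w => (G (normSqs w) : ℂ)) _ z := h
  rw [h'.fderiv]
  -- Moving only `zᵢ`, in the direction `c`, changes only `|zᵢ|²`, at the rate `2 Re (conj zᵢ · c)`.
  have hs : (ContinuousLinearMap.pi fun j =>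
      (2 * (z j).re) • Complex.reCLM.comp (ContinuousLinearMap.proj (R := ℝ) j) +
      (2 * (z j).im) • Complex.imCLM.comp (ContinuousLinearMap.proj (R := ℝ) j))
        (Pi.single i c : Fin n → ℂ) =
      (2 * (z i).re * c.re + 2 * (z i).im * c.im) • (Pi.single i 1 : Fin n → ℝ) := by
    ext j
    rcases eq_or_ne j i with rfl | hj
    · simp
    · simp [hj]
  simp only [ContinuousLinearMap.comp_apply]
  erw [hs]
  simp [partialDeriv]

theorem wirtinger_comp_normSqs {G : (Fin n → ℝ) → ℝ} (hG : DifferentiableAt ℝ G (normSqs z))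
    (i : Fin n) :
    wirtinger i (fun w => (G (normSqs w) : ℂ)) z
      = conj (z i) * (partialDeriv i G (normSqs z) : ℂ) := by
  rw [wirtinger, fderiv_ofReal_comp_normSqs hG, fderiv_ofReal_comp_normSqs hG]
  apply Complex.ext <;> simp <;> ring

theorem wirtingerBar_comp_normSqs {G : (Fin n → ℝ) → ℝ} (hG : DifferentiableAt ℝ G (normSqs z))
    (i : Fin n) :
    wirtingerBar i (fun w => (G (normSqs w) : ℂ)) z
      = z i * (partialDeriv i G (normSqs z) : ℂ) := by
  rw [wirtingerBar, fderiv_ofReal_comp_normSqs hG, fderiv_ofReal_comp_normSqs hG]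
  apply Complex.ext <;> simp <;> ring

theorem differentiableAt_coord (j : Fin n) : DifferentiableAt ℝ (fun w : Fin n → ℂ => w j) z :=
  (hasFDerivAt_coord j).differentiableAt

theorem differentiableAt_conj_coord (j : Fin n) :
    DifferentiableAt ℝ (fun w : Fin n → ℂ => conj (w j)) z :=
  (hasFDerivAt_conj_coord j).differentiableAt

theorem differentiableAt_ofReal_comp_normSqs {G : (Fin n → ℝ) → ℝ}
    (hG : DifferentiableAt ℝ G (normSqs z)) :
    DifferentiableAt ℝ (fun w => (G (normSqs w) : ℂ)) z :=
  (Complex.ofRealCLM.hasFDerivAt.comp z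
    (hG.hasFDerivAt.comp z (hasFDerivAt_normSqs z))).differentiableAt

theorem ContDiffAt.partialDeriv {G : (Fin n → ℝ) → ℝ} {r : Fin n → ℝ} {k : ℕ}
    (hG : ContDiffAt ℝ (k + 1) G r) (i : Fin n) : ContDiffAt ℝ k (partialDeriv i G) r :=
  (hG.fderiv_right le_rfl).clm_apply contDiffAt_const

theorem eventually_differentiableAt_comp_normSqs {G : (Fin n → ℝ) → ℝ} {k : ℕ}
    (hG : ContDiffAt ℝ (k + 1) G (normSqs z)) :
    ∀ᶠ w in nhds z, DifferentiableAt ℝ G (normSqs w) := by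
  have h := hG.eventually (by exact_mod_cast WithTop.coe_ne_top)
  exact (continuous_normSqs.continuousAt.eventually h).mono fun w hw =>
    hw.differentiableAt (by simp)

/-- The complex Hessian of a function of the squared absolute values of the coordinates. -/
theorem wirtinger_wirtingerBar_comp_normSqs {G : (Fin n → ℝ) → ℝ}
    (hG : ContDiffAt ℝ 2 G (normSqs z)) (i j : Fin n) :
    wirtinger i (wirtingerBar j fun w => (G (normSqs w) : ℂ)) z
      = (if i = j then 1 else 0) * (partialDeriv j G (normSqs z) : ℂ)
        + conj (z i) * z j * (partialDeriv i (partialDeriv j G) (normSqs z) : ℂ) := by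
  have hG' : ContDiffAt ℝ ((1 : ℕ) + 1) G (normSqs z) := by norm_num; exact hG
  have h1 : (wirtingerBar j fun w => (G (normSqs w) : ℂ))
      =ᶠ[nhds z] fun w => w j * (partialDeriv j G (normSqs w) : ℂ) := by
    filter_upwards [eventually_differentiableAt_comp_normSqs hG'] with w hw
    exact wirtingerBar_comp_normSqs hw j
  have h2 : DifferentiableAt ℝ (partialDeriv j G) (normSqs z) :=
    (hG'.partialDeriv j).differentiableAt (by simp)
  rw [wirtinger_congr i h1, wirtinger_mul i (differentiableAt_coord j)
    (differentiableAt_ofReal_comp_normSqs h2), wirtinger_comp_normSqs h2, wirtinger_coord]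
  ring

end Wirtinger

/-! ### Power series in several variables -/

section PowerSeries

variable {n : ℕ}

/-- The monomial `x ^ m` in several variables. -/
def mpow {R : Type*} [CommMonoid R] (x : Fin n → R) (m : Fin n → ℕ) : R := ∏ i, x i ^ m i

theorem mpow_cons {R : Type*} [CommMonoid R] (x : Fin (n + 1) → R) (k : ℕ) (m : Fin n → ℕ) :
    mpow x (Fin.cons k m) = x 0 ^ k * mpow (fun i => x i.succ) m := by
  simp [mpow, Fin.prod_univ_succ]

theorem mpow_add {R : Type*} [CommMonoid R] (x : Fin n → R) (m l : Fin n → ℕ) :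
    mpow x (m + l) = mpow x m * mpow x l := by
  simp [mpow, pow_add, Finset.prod_mul_distrib]

theorem mpow_mul {R : Type*} [CommMonoid R] (x y : Fin n → R) (m : Fin n → ℕ) :
    mpow (fun i => x i * y i) m = mpow x m * mpow y m := by
  simp [mpow, mul_pow, Finset.prod_mul_distrib]

theorem norm_mpow {𝕜 : Type*} [NormedField 𝕜] (x : Fin n → 𝕜) (m : Fin n → ℕ) :
    ‖mpow x m‖ = mpow (fun i => ‖x i‖) m := by
  simp [mpow, norm_prod]

theorem mpow_nonneg {x : Fin n → ℝ} (hx : ∀ i, 0 ≤ x i) (m : Fin n → ℕ) : 0 ≤ mpow x m :=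
  Finset.prod_nonneg fun i _ => pow_nonneg (hx i) _

theorem mpow_pos {x : Fin n → ℝ} (hx : ∀ i, 0 < x i) (m : Fin n → ℕ) : 0 < mpow x m :=
  Finset.prod_pos fun i _ => pow_pos (hx i) _

theorem mpow_le_mpow {x y : Fin n → ℝ} (hx : ∀ i, 0 ≤ x i) (h : ∀ i, x i ≤ y i) (m : Fin n → ℕ) :
    mpow x m ≤ mpow y m :=
  Finset.prod_le_prod (fun i _ => pow_nonneg (hx i) _)
    fun i _ => pow_le_pow_left₀ (hx i) (h i) _

theorem mpow_zero {R : Type*} [CommMonoid R] (x : Fin n → R) : mpow x 0 = 1 := by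
  simp [mpow]

theorem mpow_single {R : Type*} [CommMonoid R] (x : Fin n → R) (i : Fin n) :
    mpow x (Pi.single i 1) = x i := by
  rw [mpow, Finset.prod_eq_single i]
  · simp
  · intro j _ hj
    simp [hj]
  · simp

/-- A product of geometric series, one coordinate at a time. Absolute summability is carried through
the induction because multiplying two series needs it. -/
theorem summable_norm_mpow_and_hasSum {𝕜 : Type*} [NormedField 𝕜] [CompleteSpace 𝕜] :
    ∀ {n : ℕ} (x : Fin n → 𝕜), (∀ i, ‖x i‖ < 1) →
      Summable (fun m => ‖mpow x m‖) ∧ HasSum (mpow x) (∏ i, (1 - x i)⁻¹)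
  | 0, x, _ => by
    refine ⟨(hasSum_unique _).summable, ?_⟩
    convert! hasSum_unique (mpow x) using 1
  | n + 1, x, h => by
    obtain ⟨h1, h2⟩ := summable_norm_mpow_and_hasSum (fun i => x i.succ) fun i => h i.succ
    have h3 := hasSum_geometric_of_norm_lt_one (h 0)
    have h4 : Summable fun k : ℕ => ‖x 0 ^ k‖ := by
      simpa using summable_geometric_of_lt_one (norm_nonneg _) (h 0)
    have h5 := h4.mul_norm h1
    constructor
    · rw [← (Fin.consEquiv (fun _ : Fin (n + 1) => ℕ)).summable_iff]
      convert! h5 using 2 with p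
      simp [Fin.consEquiv, mpow_cons]
    · rw [← (Fin.consEquiv (fun _ : Fin (n + 1) => ℕ)).hasSum_iff, Fin.prod_univ_succ]
      convert! h3.mul h2 h5.of_norm using 2 with p
      simp [Fin.consEquiv, mpow_cons]

theorem hasSum_mpow {𝕜 : Type*} [NormedField 𝕜] [CompleteSpace 𝕜] {x : Fin n → 𝕜}
    (h : ∀ i, ‖x i‖ < 1) : HasSum (mpow x) (∏ i, (1 - x i)⁻¹) :=
  (summable_norm_mpow_and_hasSum x h).2

theorem summable_norm_mpow {𝕜 : Type*} [NormedField 𝕜] [CompleteSpace 𝕜] {x : Fin n → 𝕜}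
    (h : ∀ i, ‖x i‖ < 1) : Summable fun m => ‖mpow x m‖ :=
  (summable_norm_mpow_and_hasSum x h).1

/-- The sum of the power series with coefficients `a`. -/
noncomputable def mseries (a : (Fin n → ℕ) → ℝ) (r : Fin n → ℝ) : ℝ := ∑' m, a m * mpow r m

/-- The coefficients of the `i`-th partial derivative of the power series with coefficients `a`. -/
def mderiv (i : Fin n) (a : (Fin n → ℕ) → ℝ) (m : Fin n → ℕ) : ℝ :=
  (m i + 1) * a (m + Pi.single i 1)

/-- The coefficients `a` grow at most geometrically. -/
def GeomBounded (a : (Fin n → ℕ) → ℝ) : Prop :=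
  ∃ C R : ℝ, 0 < R ∧ ∀ m, |a m| * mpow (fun _ => R) m ≤ C

/-- Halving the radius absorbs the factor `mᵢ + 1`, because `k + 1 ≤ 2 ^ k`. -/
theorem GeomBounded.mderiv {a : (Fin n → ℕ) → ℝ} (ha : GeomBounded a) (i : Fin n) :
    GeomBounded (mderiv i a) := by
  obtain ⟨C, R, hR, h⟩ := ha
  refine ⟨C / R, R / 2, by positivity, fun m => ?_⟩
  have h1 := h (m + Pi.single i 1)
  rw [mpow_add, mpow_single] at h1
  have h2 : mpow (fun _ : Fin n => R / 2) m = mpow (fun _ => R) m * mpow (fun _ => 1 / 2) m := by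
    rw [← mpow_mul]
    congr 1
    ext
    ring
  have h3 : ((m i : ℝ) + 1) * mpow (fun _ => 1 / 2) m ≤ 1 := by
    have h4 : mpow (fun _ : Fin n => (1 / 2 : ℝ)) m ≤ (1 / 2) ^ m i := by
      rw [mpow, ← Finset.mul_prod_erase _ _ (Finset.mem_univ i)]
      apply mul_le_of_le_one_right (by positivity)
      exact Finset.prod_le_one (fun _ _ => by positivity)
        fun _ _ => pow_le_one₀ (by norm_num) (by norm_num)
    have h5 : ((m i : ℝ) + 1) ≤ 2 ^ m i := by
      exact_mod_cast Nat.lt_two_pow_self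
    calc ((m i : ℝ) + 1) * mpow (fun _ => 1 / 2) m ≤ 2 ^ m i * (1 / 2) ^ m i :=
          mul_le_mul h5 h4 (mpow_nonneg (fun _ => by norm_num) m) (by positivity)
      _ = 1 := by rw [← mul_pow]; norm_num
  rw [_root_.mderiv, abs_mul, abs_of_nonneg (by positivity : (0 : ℝ) ≤ m i + 1), h2, le_div_iff₀ hR]
  have h6 : 0 ≤ |a (m + Pi.single i 1)| * (mpow (fun _ => R) m * R) := by
    have := mpow_pos (x := fun _ : Fin n => R) (fun _ => hR) m
    positivity
  calc _ = (|a (m + Pi.single i 1)| * (mpow (fun _ => R) m * R)) *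
        (((m i : ℝ) + 1) * mpow (fun _ => 1 / 2) m) := by ring
    _ ≤ |a (m + Pi.single i 1)| * (mpow (fun _ => R) m * R) := mul_le_of_le_one_right h6 h3
    _ ≤ C := h1

theorem hasFDerivAt_mpow (m : Fin n → ℕ) (r : Fin n → ℝ) :
    HasFDerivAt (fun r : Fin n → ℝ => mpow r m)
      (∑ i, (m i * mpow r (m - Pi.single i 1)) •
        (ContinuousLinearMap.proj i : (Fin n → ℝ) →L[ℝ] ℝ)) r := by
  have h : ∀ i ∈ Finset.univ, HasFDerivAt (fun r : Fin n → ℝ => r i ^ m i)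
      ((m i * r i ^ (m i - 1)) • (ContinuousLinearMap.proj i : (Fin n → ℝ) →L[ℝ] ℝ)) r := by
    intro i _
    have := ((ContinuousLinearMap.proj (R := ℝ) (φ := fun _ : Fin n => ℝ) i).hasFDerivAt
      (x := r)).pow (m i)
    simpa using this
  refine (HasFDerivAt.finsetProd h).congr_fderiv ?_
  refine Finset.sum_congr rfl fun i hi => ?_
  rw [smul_smul, mpow, ← Finset.mul_prod_erase _ _ hi]
  congr 1
  have : ∏ j ∈ Finset.univ.erase i, r j ^ (m - Pi.single i 1 : Fin n → ℕ) j
      = ∏ j ∈ Finset.univ.erase i, r j ^ m j := by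
    refine Finset.prod_congr rfl fun j hj => ?_
    simp [Finset.ne_of_mem_erase hj]
  rw [this]
  simp
  ring

/-- Doubling the radius pays for the factor `mᵢ ≤ 2 ^ mᵢ` produced by differentiation. When `mᵢ = 0`
the truncated exponent is harmless, since that factor is zero. -/
theorem mpow_const_le {ρ : ℝ} (hρ : 0 < ρ) (m : Fin n → ℕ) (i : Fin n) :
    m i * mpow (fun _ => ρ) (m - Pi.single i 1) ≤ ρ⁻¹ * mpow (fun _ => 2 * ρ) m := by
  have h0 := mpow_pos (x := fun _ : Fin n => 2 * ρ) (fun _ => by positivity) m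
  rcases Nat.eq_zero_or_pos (m i) with h | h
  · rw [h]
    simp
    positivity
  have h1 : m = (m - Pi.single i 1) + Pi.single i 1 := by
    ext j
    rcases eq_or_ne j i with rfl | hj
    · simp; omega
    · simp [hj]
  have h2 : mpow (fun _ : Fin n => ρ) m = mpow (fun _ => ρ) (m - Pi.single i 1) * ρ := by
    conv_lhs => rw [h1, mpow_add, mpow_single]
  have h3 : (m i : ℝ) ≤ mpow (fun _ : Fin n => (2 : ℝ)) m := by
    have h4 : (2 : ℝ) ^ m i ≤ mpow (fun _ : Fin n => (2 : ℝ)) m := by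
      rw [mpow, ← Finset.mul_prod_erase _ _ (Finset.mem_univ i)]
      exact le_mul_of_one_le_right (by positivity)
        (by
          simpa using Finset.prod_le_prod (s := Finset.univ.erase i) (f := fun _ => (1 : ℝ))
            (g := fun j => 2 ^ m j) (fun _ _ => zero_le_one) fun _ _ => one_le_pow₀ (by norm_num))
    refine le_trans ?_ h4
    exact_mod_cast Nat.lt_two_pow_self.le
  have h5 : 0 < mpow (fun _ : Fin n => ρ) m := mpow_pos (fun _ => hρ) m
  rw [mpow_mul, inv_mul_eq_div, le_div_iff₀ hρ, mul_assoc, ← h2]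
  gcongr

theorem GeomBounded.hasFDerivAt_mseries {a : (Fin n → ℕ) → ℝ} (ha : GeomBounded a) :
    ∀ᶠ r in nhds 0, HasFDerivAt (mseries a)
      (∑ i, mseries (_root_.mderiv i a) r •
        (ContinuousLinearMap.proj i : (Fin n → ℝ) →L[ℝ] ℝ)) r := by
  obtain ⟨C, R, hR, h⟩ := id ha
  have hgeom : Summable fun m : Fin n → ℕ => mpow (fun _ => (1 / 2 : ℝ)) m :=
    (summable_norm_mpow (x := fun _ : Fin n => (1 / 2 : ℝ)) fun _ => by norm_num).of_norm
  -- On the polydisc of radius `R / 4`, differentiating a monomial costs a doubling to `R / 2`; the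
  -- remaining gap up to `R` leaves the summable majorant `(1/2)^m`.
  have hbound : ∀ (m : Fin n → ℕ) (x : Fin n → ℝ), (∀ j, ‖x j‖ ≤ R / 4) → ∀ i,
      ‖a m * (m i * mpow x (m - Pi.single i 1))‖
        ≤ C * (R / 4)⁻¹ * mpow (fun _ => (1 / 2 : ℝ)) m := by
    intro m x hx i
    have h1 : ‖(m i * mpow x (m - Pi.single i 1) : ℝ)‖
        ≤ (R / 4)⁻¹ * mpow (fun _ => 2 * (R / 4)) m := by
      rw [norm_mul, norm_mpow, Real.norm_natCast]
      refine le_trans ?_ (mpow_const_le (by positivity) m i)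
      gcongr
      exact mpow_le_mpow (fun _ => norm_nonneg _) hx _
    have h2 : mpow (fun _ : Fin n => 2 * (R / 4)) m
        = mpow (fun _ => R) m * mpow (fun _ => (1 / 2 : ℝ)) m := by
      rw [← mpow_mul]
      congr 1
      ext
      ring
    have h3 := mpow_pos (x := fun _ : Fin n => (1 / 2 : ℝ)) (fun _ => by norm_num) m
    rw [norm_mul, Real.norm_eq_abs (a m)]
    calc _ ≤ |a m| * ((R / 4)⁻¹ * mpow (fun _ => 2 * (R / 4)) m) := by gcongr
      _ = (|a m| * mpow (fun _ => R) m) * ((R / 4)⁻¹ * mpow (fun _ => (1 / 2 : ℝ)) m) := by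
        rw [h2]; ring
      _ ≤ C * ((R / 4)⁻¹ * mpow (fun _ => (1 / 2 : ℝ)) m) := by gcongr; exact h m
      _ = _ := by ring
  have hs : ∀ (x : Fin n → ℝ), (∀ j, ‖x j‖ ≤ R / 4) → ∀ i, HasSum
      (fun m => a m * (m i * mpow x (m - Pi.single i 1))) (mseries (_root_.mderiv i a) x) := by
    intro x hx i
    have hsum : Summable fun m => a m * (m i * mpow x (m - Pi.single i 1)) :=
      Summable.of_norm_bounded (hgeom.mul_left _) fun m => hbound m x hx i
    -- Reindexing by `m ↦ m + eᵢ` loses nothing: the terms outside the range have `mᵢ = 0` and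
    -- vanish.
    have hinj : Function.Injective fun m : Fin n → ℕ => m + Pi.single i 1 :=
      add_left_injective _
    rw [hsum.hasSum_iff, mseries, ← hinj.tsum_eq]
    · refine tsum_congr fun m => ?_
      have : m + Pi.single i 1 - Pi.single i 1 = m := by
        ext j
        simp
      rw [this, _root_.mderiv]
      simp
      ring
    · intro m hm
      have hmi : m i ≠ 0 := by
        rintro h0
        simp [h0] at hm
      refine ⟨m - Pi.single i 1, ?_⟩
      ext j
      rcases eq_or_ne j i with rfl | hj
      · simp; omega
      · simp [hj]
  filter_upwards [Metric.ball_mem_nhds (0 : Fin n → ℝ) (by positivity : 0 < R / 4)] with r hr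
  have hball : ∀ x ∈ Metric.ball (0 : Fin n → ℝ) (R / 4), ∀ j, ‖x j‖ ≤ R / 4 := fun x hx j =>
    (norm_le_pi_norm x j).trans (mem_ball_zero_iff.1 hx).le
  have key := hasFDerivAt_tsum_of_isPreconnected (𝕜 := ℝ)
    (f := fun (m : Fin n → ℕ) (r : Fin n → ℝ) => a m * mpow r m)
    (f' := fun m r => a m • (∑ i, (m i * mpow r (m - Pi.single i 1)) •
        (ContinuousLinearMap.proj i : (Fin n → ℝ) →L[ℝ] ℝ)))
    (u := fun m => ∑ _i : Fin n, C * (R / 4)⁻¹ * mpow (fun _ => (1 / 2 : ℝ)) m)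
    (x₀ := 0) (x := r) (summable_sum fun _ _ => hgeom.mul_left _) Metric.isOpen_ball
    (convex_ball (0 : Fin n → ℝ) (R / 4)).isPreconnected
    (fun m x _ => (hasFDerivAt_mpow m x).const_mul (a m)) ?_
    (Metric.mem_ball_self (by positivity)) ?_ hr
  · refine key.congr_fderiv ?_
    symm
    have : HasSum (fun m => ∑ i, (a m * (m i * mpow r (m - Pi.single i 1))) •
        (ContinuousLinearMap.proj i : (Fin n → ℝ) →L[ℝ] ℝ)) (∑ i, mseries (_root_.mderiv i a) r •
        (ContinuousLinearMap.proj i : (Fin n → ℝ) →L[ℝ] ℝ)) :=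
      hasSum_sum fun i _ => (hs r (hball r hr) i).smul_const _
    rw [← this.tsum_eq]
    refine tsum_congr fun m => ?_
    simp [Finset.smul_sum, smul_smul]
  · intro m x hx
    rw [Finset.smul_sum]
    refine norm_sum_le_of_le _ fun i _ => ?_
    rw [smul_smul, norm_smul]
    refine le_trans (mul_le_of_le_one_right (norm_nonneg _) ?_) (hbound m x (hball x hx) i)
    exact ContinuousLinearMap.opNorm_le_bound _ zero_le_one fun v => by
      simpa using norm_le_pi_norm v i
  · refine (hasSum_single 0 fun m hm => ?_).summable
    obtain ⟨i, hi⟩ : ∃ i, m i ≠ 0 := by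
      by_contra! hcon
      exact hm (funext hcon)
    rw [mpow, Finset.prod_eq_zero (Finset.mem_univ i) (by simp [hi]), mul_zero]

/-- The partial derivatives are again geometrically bounded series, so the induction on `k` runs
over all such coefficient families at once. -/
theorem GeomBounded.contDiffAt_mseries {a : (Fin n → ℕ) → ℝ} (ha : GeomBounded a) (k : ℕ) :
    ContDiffAt ℝ k (mseries a) 0 := by
  induction k generalizing a with
  | zero =>
    have h := ha.hasFDerivAt_mseries
    refine contDiffAt_zero.2 ⟨_, h, fun x hx => ?_⟩
    exact HasFDerivAt.continuousAt hx |>.continuousWithinAt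
  | succ k ih =>
    exact contDiffAt_succ_iff_hasFDerivAt.2 ⟨_, ⟨_, ha.hasFDerivAt_mseries, fun x hx => hx⟩,
      ContDiffAt.sum fun i _ => (ih (ha.mderiv i)).smul contDiffAt_const⟩

theorem GeomBounded.partialDeriv_mseries {a : (Fin n → ℕ) → ℝ} (ha : GeomBounded a) (i : Fin n) :
    partialDeriv i (mseries a) =ᶠ[nhds 0] mseries (_root_.mderiv i a) := by
  filter_upwards [ha.hasFDerivAt_mseries] with r hr
  rw [partialDeriv, hr.fderiv]
  simp [Pi.single_apply]

theorem mseries_zero (a : (Fin n → ℕ) → ℝ) : mseries a 0 = a 0 := by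
  rw [mseries, tsum_eq_single 0 fun m hm => ?_]
  · simp [mpow_zero]
  · obtain ⟨i, hi⟩ : ∃ i, m i ≠ 0 := by
      by_contra! hcon
      exact hm (funext hcon)
    rw [mpow, Finset.prod_eq_zero (Finset.mem_univ i) (by simp [hi]), mul_zero]

end PowerSeries

/-! ### Ricci curvature at the origin -/

section Origin

variable {n : ℕ} {L : (Fin n → ℝ) → ℝ} {M : (Fin n → ℂ) → Matrix (Fin n) (Fin n) ℂ}

theorem normSqs_zero : normSqs (0 : Fin n → ℂ) = 0 := by
  ext
  simp [normSqs]

theorem wirtinger_coord_mul_zero {G : (Fin n → ℝ) → ℝ} (hG : DifferentiableAt ℝ G 0)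
    (k l : Fin n) : wirtinger k (fun w => w l * (G (normSqs w) : ℂ)) 0
      = if k = l then (G 0 : ℂ) else 0 := by
  rw [← normSqs_zero] at hG
  rw [wirtinger_mul k (differentiableAt_coord l) (differentiableAt_ofReal_comp_normSqs hG),
    wirtinger_coord, normSqs_zero]
  simp

theorem eventually_metric_eq (hL : ContDiffAt ℝ 4 L 0) {i j : Fin n}
    (hM : (fun z => M z i j)
      =ᶠ[nhds 0] wirtinger i (wirtingerBar j fun w => (L (normSqs w) : ℂ))) :
    (fun z => M z i j) =ᶠ[nhds 0] fun z =>
      (if i = j then 1 else 0) * (partialDeriv j L (normSqs z) : ℂ)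
        + conj (z i) * (z j * (partialDeriv i (partialDeriv j L) (normSqs z) : ℂ)) := by
  rw [← normSqs_zero] at hL
  have h : ∀ᶠ z in nhds (0 : Fin n → ℂ), ContDiffAt ℝ 4 L (normSqs z) :=
    continuous_normSqs.continuousAt.eventually (hL.eventually (by norm_num))
  filter_upwards [hM, h] with z h1 h2
  rw [h1, wirtinger_wirtingerBar_comp_normSqs (h2.of_le (by norm_num)) i j]
  ring

/-- Each term of the derivative keeps a coordinate or a conjugate coordinate as a factor. This
removes the quadratic part of the curvature at the origin. -/
theorem wirtinger_metric_zero (hL : ContDiffAt ℝ 4 L 0) {i j : Fin n}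
    (hM : (fun z => M z i j)
      =ᶠ[nhds 0] wirtinger i (wirtingerBar j fun w => (L (normSqs w) : ℂ))) (k : Fin n) :
    wirtinger k (fun z => M z i j) 0 = 0 := by
  rw [wirtinger_congr k (eventually_metric_eq hL hM)]
  have hL' : ContDiffAt ℝ ((3 : ℕ) + 1) L (normSqs (0 : Fin n → ℂ)) := by
    rw [normSqs_zero]; norm_num; exact hL
  have h1 : ContDiffAt ℝ ((2 : ℕ) + 1) (partialDeriv j L) (normSqs (0 : Fin n → ℂ)) := by
    exact_mod_cast hL'.partialDeriv j
  have h2 := h1.partialDeriv i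
  have d1 := h1.differentiableAt (by norm_num)
  have d2 := h2.differentiableAt (by norm_num)
  have e1 := differentiableAt_ofReal_comp_normSqs d1
  have e2 := (differentiableAt_coord (z := (0 : Fin n → ℂ)) j).fun_mul
    (differentiableAt_ofReal_comp_normSqs d2)
  rw [wirtinger_add k ((differentiableAt_const _).fun_mul e1) ((differentiableAt_conj_coord i).fun_mul e2),
    wirtinger_mul k (differentiableAt_const _) e1, wirtinger_mul k (differentiableAt_conj_coord i) e2,
    wirtinger_comp_normSqs d1, wirtinger_const, wirtinger_conj_coord]
  simp

/-- This is the coefficient of `|z_k|²` in `g_{iī} = L_i + |zᵢ|² L_{ii}`. The first summand always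
contributes `L_{ik}`; the second contributes `L_{ii}` once more when `i = k`. -/
theorem wirtinger_wirtingerBar_metric_zero (hL : ContDiffAt ℝ 4 L 0) {i : Fin n}
    (hM : (fun z => M z i i)
      =ᶠ[nhds 0] wirtinger i (wirtingerBar i fun w => (L (normSqs w) : ℂ))) (k : Fin n) :
    wirtinger k (wirtingerBar k (fun z => M z i i)) 0
      = (1 + if i = k then 1 else 0) * (partialDeriv k (partialDeriv i L) 0 : ℂ) := by
  have hL' : ContDiffAt ℝ ((3 : ℕ) + 1) L (normSqs (0 : Fin n → ℂ)) := by
    rw [normSqs_zero]; norm_num; exact hL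
  have h1 : ContDiffAt ℝ ((2 : ℕ) + 1) (partialDeriv i L) (normSqs (0 : Fin n → ℂ)) := by
    exact_mod_cast hL'.partialDeriv i
  have h2 : ContDiffAt ℝ ((1 : ℕ) + 1) (partialDeriv i (partialDeriv i L))
      (normSqs (0 : Fin n → ℂ)) := by
    exact_mod_cast h1.partialDeriv i
  have h3 : ContDiffAt ℝ ((0 : ℕ) + 1) (partialDeriv k (partialDeriv i (partialDeriv i L)))
      (normSqs (0 : Fin n → ℂ)) := by
    exact_mod_cast h2.partialDeriv k
  have h4 : ContDiffAt ℝ ((1 : ℕ) + 1) (partialDeriv k (partialDeriv i L))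
      (normSqs (0 : Fin n → ℂ)) := by
    exact_mod_cast h1.partialDeriv k
  -- The terms are grouped so that a coordinate factor stands in front of each. Applying `∂_k` at
  -- the origin then kills the middle term, through its factor `conj zᵢ`, and strips the factor from
  -- the outer ones.
  have key : wirtingerBar k (fun z => M z i i) =ᶠ[nhds 0] fun z =>
      z k * (partialDeriv k (partialDeriv i L) (normSqs z) : ℂ)
      + (conj (z i) * (z i * (z k *
          (partialDeriv k (partialDeriv i (partialDeriv i L)) (normSqs z) : ℂ)))
        + (if k = i then 1 else 0) * (z i * (partialDeriv i (partialDeriv i L) (normSqs z) : ℂ))) := by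
    filter_upwards [eventually_differentiableAt_comp_normSqs h1,
      eventually_differentiableAt_comp_normSqs h2,
      (eventually_metric_eq hL hM).eventually_nhds] with z d1 d2 h
    have e1 := differentiableAt_ofReal_comp_normSqs d1
    have e2' := differentiableAt_ofReal_comp_normSqs d2
    have e2 := (differentiableAt_coord (z := z) i).fun_mul e2'
    rw [wirtingerBar_congr k h]
    simp only [if_true, one_mul]
    rw [wirtingerBar_add k e1 ((differentiableAt_conj_coord i).fun_mul e2),
      wirtingerBar_mul k (differentiableAt_conj_coord i) e2,
      wirtingerBar_mul k (differentiableAt_coord i) e2', wirtingerBar_comp_normSqs d1,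
      wirtingerBar_comp_normSqs d2, wirtingerBar_conj_coord, wirtingerBar_coord]
    ring
  have d2 := h2.differentiableAt (by norm_num)
  have d3 := h3.differentiableAt (by norm_num)
  have d4 := h4.differentiableAt (by norm_num)
  have e3 := (differentiableAt_coord (z := (0 : Fin n → ℂ)) k).fun_mul
    (differentiableAt_ofReal_comp_normSqs d3)
  have e3' := (differentiableAt_coord (z := (0 : Fin n → ℂ)) i).fun_mul e3
  have e4 := (differentiableAt_coord (z := (0 : Fin n → ℂ)) k).fun_mul
    (differentiableAt_ofReal_comp_normSqs d4)
  have e2 := (differentiableAt_coord (z := (0 : Fin n → ℂ)) i).fun_mul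
    (differentiableAt_ofReal_comp_normSqs d2)
  have c : DifferentiableAt ℝ (fun _ : Fin n → ℂ => (if k = i then 1 else 0 : ℂ)) 0 :=
    differentiableAt_const _
  rw [wirtinger_congr k key, wirtinger_add k e4
    (((differentiableAt_conj_coord i).fun_mul e3').fun_add (c.fun_mul e2)),
    wirtinger_add k ((differentiableAt_conj_coord i).fun_mul e3') (c.fun_mul e2),
    wirtinger_mul k (differentiableAt_conj_coord i) e3', wirtinger_mul k c e2,
    wirtinger_const, wirtinger_conj_coord]
  rw [normSqs_zero] at d2 d4
  rw [wirtinger_coord_mul_zero d4, wirtinger_coord_mul_zero d2]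
  rcases eq_or_ne k i with rfl | h
  · simp
    ring
  · simp [h, h.symm]

theorem wirtingerBar_metric_zero (hL : ContDiffAt ℝ 4 L 0) {i j : Fin n}
    (hM : (fun z => M z i j)
      =ᶠ[nhds 0] wirtinger i (wirtingerBar j fun w => (L (normSqs w) : ℂ))) (k : Fin n) :
    wirtingerBar k (fun z => M z i j) 0 = 0 := by
  rw [wirtingerBar_congr k (eventually_metric_eq hL hM)]
  have hL' : ContDiffAt ℝ ((3 : ℕ) + 1) L (normSqs (0 : Fin n → ℂ)) := by
    rw [normSqs_zero]; norm_num; exact hL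
  have h1 : ContDiffAt ℝ ((2 : ℕ) + 1) (partialDeriv j L) (normSqs (0 : Fin n → ℂ)) := by
    exact_mod_cast hL'.partialDeriv j
  have h2 := h1.partialDeriv i
  have d1 := h1.differentiableAt (by norm_num)
  have d2 := h2.differentiableAt (by norm_num)
  have e1 := differentiableAt_ofReal_comp_normSqs d1
  have e2 := (differentiableAt_coord (z := (0 : Fin n → ℂ)) j).fun_mul
    (differentiableAt_ofReal_comp_normSqs d2)
  rw [wirtingerBar_add k ((differentiableAt_const _).fun_mul e1)
      ((differentiableAt_conj_coord i).fun_mul e2),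
    wirtingerBar_mul k (differentiableAt_const _) e1,
    wirtingerBar_mul k (differentiableAt_conj_coord i) e2,
    wirtingerBar_comp_normSqs d1, wirtingerBar_const]
  simp

theorem metric_zero_eq_diagonal (hL : ContDiffAt ℝ 4 L 0)
    (hM : ∀ i j, (fun z => M z i j)
      =ᶠ[nhds 0] wirtinger i (wirtingerBar j fun w => (L (normSqs w) : ℂ))) :
    M 0 = Matrix.diagonal fun i => (partialDeriv i L 0 : ℂ) := by
  ext i j
  rw [(eventually_metric_eq hL (hM i j)).eq_of_nhds]
  rcases eq_or_ne i j with rfl | h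
  · simp [normSqs_zero]
  · simp [h]

theorem ricciCurvature_zero (hL : ContDiffAt ℝ 4 L 0)
    (hM : ∀ i j, (fun z => M z i j)
      =ᶠ[nhds 0] wirtinger i (wirtingerBar j fun w => (L (normSqs w) : ℂ)))
    (h0 : ∀ i, partialDeriv i L 0 ≠ 0) (k : Fin n) :
    ricciCurvature M 0 k k = ((-∑ i, (1 + if i = k then 1 else 0) *
      partialDeriv k (partialDeriv i L) 0 / partialDeriv i L 0 : ℝ) : ℂ) := by
  have hinv : (M 0)⁻¹ = Matrix.diagonal fun i => ((partialDeriv i L 0 : ℝ) : ℂ)⁻¹ := by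
    rw [metric_zero_eq_diagonal hL hM]
    refine Matrix.inv_eq_right_inv ?_
    rw [Matrix.diagonal_mul_diagonal, ← Matrix.diagonal_one]
    congr 1
    ext i
    exact mul_inv_cancel₀ (by exact_mod_cast h0 i)
  simp only [ricciCurvature, Matrix.of_apply, chernCurvature, hinv,
    wirtinger_metric_zero hL (hM _ _), wirtingerBar_metric_zero hL (hM _ _), mul_zero,
    Finset.sum_const_zero, add_zero]
  push_cast
  rw [← Finset.sum_neg_distrib]
  refine Finset.sum_congr rfl fun i _ => ?_
  rw [Finset.sum_eq_single i]
  · rw [wirtinger_wirtingerBar_metric_zero hL (hM i i)]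
    simp only [Matrix.diagonal_apply_eq]
    split_ifs <;> push_cast <;> ring
  · intro j _ hj
    simp [hj]
  · simp

end Origin

/-! ### The Bergman metric of the ball is Kähler–Einstein -/

section Ball

variable {n : ℕ}

/-- Curvature at a point depends only on the germ of the metric, and on an open set equality at
points is equality of germs. -/
theorem IsKahlerEinstein.congr {Ω : Set (Fin n → ℂ)} (hΩ : IsOpen Ω)
    {g g' : (Fin n → ℂ) → Matrix (Fin n) (Fin n) ℂ} (h : ∀ z ∈ Ω, g z = g' z)
    (hg : IsKahlerEinstein Ω g) : IsKahlerEinstein Ω g' := by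
  have hev : ∀ z ∈ Ω, ∀ i j, (fun w => g' w i j) =ᶠ[nhds z] fun w => g w i j := by
    intro z hz i j
    filter_upwards [hΩ.mem_nhds hz] with w hw
    rw [h w hw]
  have hbar : ∀ z ∈ Ω, ∀ i j l, wirtingerBar l (fun w => g' w i j)
      =ᶠ[nhds z] wirtingerBar l fun w => g w i j := by
    intro z hz i j l
    filter_upwards [hΩ.mem_nhds hz] with w hw
    exact wirtingerBar_congr l (hev w hw i j)
  obtain ⟨⟨h1, h2, h3⟩, c, hc⟩ := hg
  refine ⟨⟨fun i j => (h1 i j).congr fun z hz => by rw [h z hz], fun z hz => h z hz ▸ h2 z hz,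
    fun z hz i j k => ?_⟩, c, fun z hz => ?_⟩
  · rw [wirtinger_congr k (hev z hz i j), wirtinger_congr i (hev z hz k j)]
    exact h3 z hz i j k
  · rw [← h z hz, ← hc z hz]
    ext k l
    simp only [ricciCurvature, chernCurvature, Matrix.of_apply, h z hz]
    refine Finset.sum_congr rfl fun i _ => Finset.sum_congr rfl fun j _ => ?_
    rw [wirtinger_congr k (hbar z hz i j l)]
    congr 2
    refine Finset.sum_congr rfl fun p _ => Finset.sum_congr rfl fun q _ => ?_
    rw [wirtinger_congr k (hev z hz i p), wirtingerBar_congr l (hev z hz q j)]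

/-- The defining function `1 / (1 - ‖z‖²)` of the unit ball. -/
noncomputable def ballWeight (z : Fin n → ℂ) : ℂ := ((1 - ∑ i, normSqs z i)⁻¹ : ℝ)

/-- The complex hyperbolic metric `-a ∂∂̄ log (1 - ‖z‖²)` of the unit ball. -/
noncomputable def ballMetric (a : ℝ) (z : Fin n → ℂ) : Matrix (Fin n) (Fin n) ℂ :=
  Matrix.of fun i j => a * ((if i = j then 1 else 0) * ballWeight z
    + conj (z i) * (z j * (ballWeight z * ballWeight z)))

/-- The open unit ball. -/
def unitBall (n : ℕ) : Set (Fin n → ℂ) := {z | ∑ i, normSqs z i < 1}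

theorem isOpen_unitBall : IsOpen (unitBall n) :=
  isOpen_lt (continuous_finsetSum _ fun i _ => (continuous_apply i).comp continuous_normSqs)
    continuous_const

variable {z : Fin n → ℂ}

theorem hasFDerivAt_inv_one_sub_sum {r : Fin n → ℝ} (hr : 1 - ∑ i, r i ≠ 0) :
    HasFDerivAt (fun r : Fin n → ℝ => (1 - ∑ i, r i)⁻¹)
      (((1 - ∑ i, r i) ^ 2)⁻¹ •
        ∑ i, (ContinuousLinearMap.proj i : (Fin n → ℝ) →L[ℝ] ℝ)) r := by
  have h : HasFDerivAt (fun r : Fin n → ℝ => 1 - ∑ i, r i)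
      (-∑ i, (ContinuousLinearMap.proj i : (Fin n → ℝ) →L[ℝ] ℝ)) r :=
    (HasFDerivAt.fun_sum fun i _ =>
      (ContinuousLinearMap.proj (R := ℝ) (φ := fun _ : Fin n => ℝ) i).hasFDerivAt).const_sub 1
  refine ((hasDerivAt_inv hr).comp_hasFDerivAt r h).congr_fderiv ?_
  simp

theorem partialDeriv_inv_one_sub_sum {r : Fin n → ℝ} (hr : 1 - ∑ i, r i ≠ 0) (i : Fin n) :
    partialDeriv i (fun r : Fin n → ℝ => (1 - ∑ i, r i)⁻¹) r = ((1 - ∑ i, r i)⁻¹) ^ 2 := by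
  rw [partialDeriv, (hasFDerivAt_inv_one_sub_sum hr).fderiv]
  simp

theorem one_sub_ne_zero (hz : z ∈ unitBall n) : 1 - ∑ i, normSqs z i ≠ 0 :=
  (sub_pos.2 hz).ne'

theorem differentiableAt_ballWeight (hz : z ∈ unitBall n) :
    DifferentiableAt ℝ (ballWeight (n := n)) z :=
  differentiableAt_ofReal_comp_normSqs
    (hasFDerivAt_inv_one_sub_sum (one_sub_ne_zero hz)).differentiableAt

theorem wirtinger_ballWeight (hz : z ∈ unitBall n) (k : Fin n) :
    wirtinger k ballWeight z = conj (z k) * ballWeight z ^ 2 := by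
  have h := wirtinger_comp_normSqs
    (hasFDerivAt_inv_one_sub_sum (one_sub_ne_zero hz)).differentiableAt k
  rw [partialDeriv_inv_one_sub_sum (one_sub_ne_zero hz)] at h
  rw [ballWeight, ← Complex.ofReal_pow]
  exact h

theorem wirtingerBar_ballWeight (hz : z ∈ unitBall n) (k : Fin n) :
    wirtingerBar k ballWeight z = z k * ballWeight z ^ 2 := by
  have h := wirtingerBar_comp_normSqs
    (hasFDerivAt_inv_one_sub_sum (one_sub_ne_zero hz)).differentiableAt k
  rw [partialDeriv_inv_one_sub_sum (one_sub_ne_zero hz)] at h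
  rw [ballWeight, ← Complex.ofReal_pow]
  exact h

theorem differentiableAt_ballMetric (a : ℝ) (hz : z ∈ unitBall n) (i j : Fin n) :
    DifferentiableAt ℝ (fun w => ballMetric a w i j) z := by
  have h := differentiableAt_ballWeight hz
  exact (((differentiableAt_const _).mul h).add ((differentiableAt_conj_coord i).mul
    ((differentiableAt_coord j).mul (h.mul h)))).const_mul (a : ℂ)

/-- Expressing the derivative through the metric itself makes closedness visible as symmetry in `i`
and `k`, and lets the inverse metric contract directly in the curvature. -/
theorem wirtinger_ballMetric (a : ℝ) (hz : z ∈ unitBall n) (i j k : Fin n) :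
    wirtinger k (fun w => ballMetric a w i j) z
      = ballWeight z * (conj (z k) * ballMetric a z i j + conj (z i) * ballMetric a z k j) := by
  have h := differentiableAt_ballWeight hz
  have hU := (differentiableAt_coord (z := z) j).fun_mul (h.fun_mul h)
  have h1 := (differentiableAt_const (if i = j then (1 : ℂ) else 0)).fun_mul h
  have h2 := (differentiableAt_conj_coord (z := z) i).fun_mul hU
  simp only [ballMetric, Matrix.of_apply]
  rw [wirtinger_mul k (differentiableAt_const _) (h1.fun_add h2), wirtinger_const,
    wirtinger_add k h1 h2, wirtinger_mul k (differentiableAt_const _) h, wirtinger_const,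
    wirtinger_mul k (differentiableAt_conj_coord i) hU, wirtinger_conj_coord,
    wirtinger_mul k (differentiableAt_coord j) (h.fun_mul h), wirtinger_coord,
    wirtinger_mul k h h, wirtinger_ballWeight hz]
  ring

theorem wirtingerBar_ballMetric (a : ℝ) (hz : z ∈ unitBall n) (i j l : Fin n) :
    wirtingerBar l (fun w => ballMetric a w i j) z
      = ballWeight z * (z l * ballMetric a z i j + z j * ballMetric a z i l) := by
  have h := differentiableAt_ballWeight hz
  have hU := (differentiableAt_coord (z := z) j).fun_mul (h.fun_mul h)
  have h1 := (differentiableAt_const (if i = j then (1 : ℂ) else 0)).fun_mul h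
  have h2 := (differentiableAt_conj_coord (z := z) i).fun_mul hU
  simp only [ballMetric, Matrix.of_apply]
  rw [wirtingerBar_mul l (differentiableAt_const _) (h1.fun_add h2), wirtingerBar_const,
    wirtingerBar_add l h1 h2, wirtingerBar_mul l (differentiableAt_const _) h, wirtingerBar_const,
    wirtingerBar_mul l (differentiableAt_conj_coord i) hU, wirtingerBar_conj_coord,
    wirtingerBar_mul l (differentiableAt_coord j) (h.fun_mul h), wirtingerBar_coord,
    wirtingerBar_mul l h h, wirtingerBar_ballWeight hz]
  simp only [eq_comm (a := l)]
  ring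

theorem wirtinger_wirtingerBar_ballMetric {a : ℝ} (ha : a ≠ 0) (hz : z ∈ unitBall n)
    (i j k l : Fin n) :
    wirtinger k (wirtingerBar l fun w => ballMetric a w i j) z
      = a⁻¹ * (ballMetric a z k l * ballMetric a z i j + ballMetric a z k j * ballMetric a z i l)
        + ballWeight z ^ 2 * (z l * (conj (z k) * ballMetric a z i j + conj (z i) * ballMetric a z k j)
          + z j * (conj (z k) * ballMetric a z i l + conj (z i) * ballMetric a z k l)) := by
  have key : (wirtingerBar l fun w => ballMetric a w i j) =ᶠ[nhds z] fun w =>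
      ballWeight w * (w l * ballMetric a w i j + w j * ballMetric a w i l) := by
    filter_upwards [isOpen_unitBall.mem_nhds hz] with w hw
    exact wirtingerBar_ballMetric a hw i j l
  have h1 := (differentiableAt_coord (z := z) l).fun_mul (differentiableAt_ballMetric a hz i j)
  have h2 := (differentiableAt_coord (z := z) j).fun_mul (differentiableAt_ballMetric a hz i l)
  rw [wirtinger_congr k key, wirtinger_mul k (differentiableAt_ballWeight hz) (h1.fun_add h2),
    wirtinger_add k h1 h2, wirtinger_mul k (differentiableAt_coord l)
      (differentiableAt_ballMetric a hz i j), wirtinger_mul k (differentiableAt_coord j)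
      (differentiableAt_ballMetric a hz i l), wirtinger_ballMetric a hz, wirtinger_ballMetric a hz,
    wirtinger_coord, wirtinger_coord, wirtinger_ballWeight hz]
  -- The definition of the metric solved for the Kronecker delta, so that the second derivative is
  -- written in metric components only.
  have hkl : ∀ m, ballWeight z * (if k = m then 1 else 0)
      = (a : ℂ)⁻¹ * ballMetric a z k m - ballWeight z ^ 2 * (conj (z k) * z m) := by
    intro m
    have : (a : ℂ) ≠ 0 := by exact_mod_cast ha
    simp only [ballMetric, Matrix.of_apply]
    field_simp
    ring
  push_cast
  linear_combination ballMetric a z i j * hkl l + ballMetric a z i l * hkl j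

theorem ballWeight_pos (hz : z ∈ unitBall n) : 0 < ballWeight z := by
  rw [ballWeight, Complex.zero_lt_real]
  exact inv_pos.2 (sub_pos.2 hz)

theorem posDef_ballMetric {a : ℝ} (ha : 0 < a) (hz : z ∈ unitBall n) :
    (ballMetric a z).PosDef := by
  have h := ballWeight_pos hz
  have ha' : (0 : ℂ) < a := Complex.zero_lt_real.2 ha
  -- A positive multiple of the identity plus a nonnegative multiple of a rank-one Gram matrix.
  have e : ballMetric a z = (a * ballWeight z) • (1 : Matrix (Fin n) (Fin n) ℂ)
      + (a * (ballWeight z * ballWeight z)) • Matrix.vecMulVec (star z) z := by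
    ext i j
    simp [ballMetric, Matrix.one_apply, Matrix.vecMulVec_apply]
    split_ifs <;> ring
  rw [e]
  exact (Matrix.PosDef.one.smul (mul_pos ha' h)).add_posSemidef
    ((Matrix.posSemidef_vecMulVec_star_self z).smul (mul_pos ha' (mul_pos h h)).le)

theorem contDiffOn_ballMetric (a : ℝ) (i j : Fin n) :
    ContDiffOn ℝ ∞ (fun z => ballMetric a z i j) (unitBall n) := by
  have h : ContDiffOn ℝ ∞ (ballWeight (n := n)) (unitBall n) := by
    have h1 : ContDiffOn ℝ ∞ (fun z : Fin n → ℂ => (1 - ∑ i, normSqs z i)⁻¹) (unitBall n) := by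
      refine ContDiffOn.inv ?_ fun z hz => one_sub_ne_zero hz
      refine (contDiff_const.sub (ContDiff.sum fun i _ => ?_)).contDiffOn
      exact (contDiff_apply ℝ ℝ i).comp contDiff_normSqs
    exact Complex.ofRealCLM.contDiff.comp_contDiffOn h1
  have hc : ∀ j, ContDiffOn ℝ ∞ (fun z : Fin n → ℂ => z j) (unitBall n) :=
    fun j => (contDiff_apply ℝ ℂ j).contDiffOn
  have hc' : ContDiffOn ℝ ∞ (fun z : Fin n → ℂ => conj (z i)) (unitBall n) :=
    (Complex.conjCLE : ℂ →L[ℝ] ℂ).contDiff.comp_contDiffOn (hc i)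
  exact contDiffOn_const.mul ((contDiffOn_const.mul h).add (hc'.mul ((hc j).mul (h.mul h))))

/-- Contracting the first derivatives with the inverse metric cancels exactly the `ballWeight ^ 2`
part of the second derivative. What remains is the curvature tensor of constant holomorphic
sectional curvature. -/
theorem chernCurvature_ballMetric {a : ℝ} (ha : 0 < a) (hz : z ∈ unitBall n) (i j k l : Fin n) :
    chernCurvature (ballMetric a) i j k l z
      = -a⁻¹ * (ballMetric a z k l * ballMetric a z i j + ballMetric a z k j * ballMetric a z i l) := by
  have hdet : IsUnit (ballMetric a z).det := (posDef_ballMetric ha hz).det_pos.ne'.isUnit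
  have hinv : ∀ i q, ∑ p, ballMetric a z i p * (ballMetric a z)⁻¹ p q = if i = q then 1 else 0 := by
    intro i q
    rw [← Matrix.mul_apply, Matrix.mul_nonsing_inv _ hdet, Matrix.one_apply]
  have hsum : ∑ p, ∑ q, (ballMetric a z)⁻¹ p q *
      wirtinger k (fun w => ballMetric a w i p) z * wirtingerBar l (fun w => ballMetric a w q j) z
      = ballWeight z * (conj (z k) * wirtingerBar l (fun w => ballMetric a w i j) z
        + conj (z i) * wirtingerBar l (fun w => ballMetric a w k j) z) := by
    rw [Finset.sum_comm]
    have : ∀ q, ∑ p, (ballMetric a z)⁻¹ p q * wirtinger k (fun w => ballMetric a w i p) z *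
        wirtingerBar l (fun w => ballMetric a w q j) z
        = ballWeight z * ((if i = q then conj (z k) * wirtingerBar l (fun w => ballMetric a w q j) z
            else 0) + if k = q then conj (z i) * wirtingerBar l (fun w => ballMetric a w q j) z
            else 0) := by
      intro q
      have e : ∀ p, (ballMetric a z)⁻¹ p q * wirtinger k (fun w => ballMetric a w i p) z *
          wirtingerBar l (fun w => ballMetric a w q j) z
          = ballWeight z * wirtingerBar l (fun w => ballMetric a w q j) z * conj (z k)
              * (ballMetric a z i p * (ballMetric a z)⁻¹ p q)
            + ballWeight z * wirtingerBar l (fun w => ballMetric a w q j) z * conj (z i)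
              * (ballMetric a z k p * (ballMetric a z)⁻¹ p q) := by
        intro p
        rw [wirtinger_ballMetric a hz]
        ring
      rw [Finset.sum_congr rfl fun p _ => e p, Finset.sum_add_distrib, ← Finset.mul_sum,
        ← Finset.mul_sum, hinv, hinv]
      split_ifs <;> ring
    rw [Finset.sum_congr rfl fun q _ => this q, ← Finset.mul_sum, Finset.sum_add_distrib]
    simp
  rw [chernCurvature, hsum, wirtinger_wirtingerBar_ballMetric ha.ne' hz,
    wirtingerBar_ballMetric a hz, wirtingerBar_ballMetric a hz]
  ring

/-- In the trace, the product `g_{k l̄} g_{i j̄}` contributes `n` copies of the metric and `g_{k j̄}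
g_{i l̄}` one more, hence `n + 1`. -/
theorem ricciCurvature_ballMetric {a : ℝ} (ha : 0 < a) (hz : z ∈ unitBall n) :
    ricciCurvature (ballMetric a) z = ((-(n + 1) / a : ℝ) : ℂ) • ballMetric a z := by
  have hdet : IsUnit (ballMetric a z).det := (posDef_ballMetric ha hz).det_pos.ne'.isUnit
  have hinv : ∀ i q, ∑ p, ballMetric a z i p * (ballMetric a z)⁻¹ p q = if i = q then 1 else 0 := by
    intro i q
    rw [← Matrix.mul_apply, Matrix.mul_nonsing_inv _ hdet, Matrix.one_apply]
  ext k l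
  simp only [ricciCurvature, Matrix.of_apply, chernCurvature_ballMetric ha hz, Matrix.smul_apply,
    smul_eq_mul]
  have e : ∀ i j, (ballMetric a z)⁻¹ j i * (-a⁻¹ * (ballMetric a z k l * ballMetric a z i j
      + ballMetric a z k j * ballMetric a z i l))
      = -a⁻¹ * ballMetric a z k l * (ballMetric a z i j * (ballMetric a z)⁻¹ j i)
        + -a⁻¹ * ballMetric a z i l * (ballMetric a z k j * (ballMetric a z)⁻¹ j i) := by
    intro i j
    ring
  simp only [e, Finset.sum_add_distrib, ← Finset.mul_sum, hinv]
  simp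
  ring

theorem isKahlerEinstein_ballMetric {a : ℝ} (ha : 0 < a) :
    IsKahlerEinstein (unitBall n) (ballMetric a) :=
  ⟨⟨contDiffOn_ballMetric a, fun _ hz => posDef_ballMetric ha hz, fun z hz i j k => by
    rw [wirtinger_ballMetric a hz, wirtinger_ballMetric a hz]
    ring⟩, _, fun _ hz => ricciCurvature_ballMetric ha hz⟩

end Ball

/-! ### Power series of holomorphic functions on Reinhardt domains -/

section Torus

variable {n : ℕ}

/-- The Haar probability measure of the torus `(ℝ / ℤ)ⁿ`, on a fundamental domain. -/
noncomputable def torus (n : ℕ) : Measure (Fin n → ℝ) :=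
  Measure.pi fun _ => volume.restrict (Set.Ioc 0 1)

instance : IsProbabilityMeasure (volume.restrict (Set.Ioc (0 : ℝ) 1)) :=
  ⟨by simp⟩

instance : IsProbabilityMeasure (torus n) := by
  unfold torus
  infer_instance

/-- The unimodular vector with arguments `2πθ`. -/
noncomputable def cis (θ : Fin n → ℝ) : Fin n → ℂ :=
  fun i => Complex.exp (2 * Real.pi * θ i * Complex.I)

theorem norm_cis (θ : Fin n → ℝ) (i : Fin n) : ‖cis θ i‖ = 1 := by
  have := Complex.norm_exp_ofReal_mul_I (2 * Real.pi * θ i)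
  push_cast at this
  exact this

theorem continuous_cis : Continuous (cis (n := n)) := by
  unfold cis
  fun_prop

theorem Continuous.integrable_torus {H : (Fin n → ℝ) → ℂ} (hH : Continuous H) :
    Integrable H (torus n) := by
  rw [torus, ← Measure.restrict_pi_pi]
  have h : IntegrableOn H (Set.Icc 0 1) volume := hH.integrableOn_Icc
  refine IntegrableOn.mono_set h fun θ hθ => ?_
  exact ⟨fun i => (hθ i trivial).1.le, fun i => (hθ i trivial).2⟩

/-- Cauchy's formula on the circle parametrized by `[0, 1]`: the derivative of the parametrization
cancels `2πi` and one factor `v`, turning `1 / (v - w)` into `(1 - w / v)⁻¹`. This form expands as a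
geometric series and iterates over coordinates. -/
theorem cauchy_one {f : ℂ → ℂ} {R : ℝ} (hR : 0 < R) {w : ℂ} (hw : ‖w‖ < R)
    (hf : ∀ v, ‖v‖ ≤ R → DifferentiableAt ℂ f v) :
    f w = ∫ t in Set.Ioc (0 : ℝ) 1, f (R * Complex.exp (2 * Real.pi * t * Complex.I)) *
      (1 - w / (R * Complex.exp (2 * Real.pi * t * Complex.I)))⁻¹ := by
  have hd : DifferentiableOn ℂ f (Metric.closedBall 0 R) := fun v hv =>
    (hf v (by simpa using hv)).differentiableWithinAt
  have h := hd.circleIntegral_sub_inv_smul (w := w) (by simpa using hw)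
  rw [circleIntegral] at h
  have h2 := intervalIntegral.smul_integral_comp_mul_left (a := 0) (b := 1)
    (f := fun θ : ℝ => (1 - w / (R * Complex.exp (θ * Complex.I)))⁻¹ *
      f (R * Complex.exp (θ * Complex.I)) * Complex.I) (2 * Real.pi)
  rw [mul_zero, mul_one] at h2
  have h3 : ∫ θ in (0 : ℝ)..2 * Real.pi, deriv (circleMap 0 R) θ • (circleMap 0 R θ - w)⁻¹ •
      f (circleMap 0 R θ) = ∫ θ in (0 : ℝ)..2 * Real.pi,
        (1 - w / (R * Complex.exp (θ * Complex.I)))⁻¹ *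
          f (R * Complex.exp (θ * Complex.I)) * Complex.I := by
    refine intervalIntegral.integral_congr fun θ _ => ?_
    have hne : (R * Complex.exp (θ * Complex.I) : ℂ) ≠ 0 :=
      mul_ne_zero (by exact_mod_cast hR.ne') (Complex.exp_ne_zero _)
    have hne2 : (R * Complex.exp (θ * Complex.I) : ℂ) - w ≠ 0 := by
      intro h0
      have h1 : ‖(R * Complex.exp (θ * Complex.I) : ℂ)‖ = R := by
        simp [Complex.norm_exp_ofReal_mul_I, abs_of_pos hR]
      rw [sub_eq_zero.1 h0] at h1
      exact hw.ne h1
    simp only [deriv_circleMap, circleMap_zero, smul_eq_mul]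
    have : (1 - w / (R * Complex.exp (θ * Complex.I)))⁻¹
        = (R * Complex.exp (θ * Complex.I)) * (R * Complex.exp (θ * Complex.I) - w)⁻¹ := by
      rw [← div_eq_mul_inv, ← inv_div (_ - w), sub_div, div_self hne]
    rw [this]
    ring
  rw [h3, ← h2, smul_eq_mul, Complex.real_smul] at h
  rw [intervalIntegral.integral_of_le zero_le_one, integral_mul_const] at h
  have hpi : (2 * Real.pi * Complex.I : ℂ) ≠ 0 := Complex.two_pi_I_ne_zero
  refine mul_left_cancel₀ hpi (h.symm.trans ?_)
  push_cast
  have : ∀ t : ℝ, (1 - w / (R * Complex.exp (2 * Real.pi * t * Complex.I)))⁻¹ *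
      f (R * Complex.exp (2 * Real.pi * t * Complex.I))
      = f (R * Complex.exp (2 * Real.pi * t * Complex.I)) *
      (1 - w / (R * Complex.exp (2 * Real.pi * t * Complex.I)))⁻¹ := fun t => mul_comm _ _
  simp only [this]
  ring

theorem continuous_cauchy_integrand {F : (Fin n → ℂ) → ℂ} {R : Fin n → ℝ} (hR : ∀ i, 0 < R i)
    {w : Fin n → ℂ} (hw : ∀ i, ‖w i‖ < R i)
    (hF : ∀ v, (∀ i, ‖v i‖ ≤ R i) → DifferentiableAt ℂ F v) :
    Continuous fun θ : Fin n → ℝ => F (fun i => R i * cis θ i) *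
      ∏ i, (1 - w i / (R i * cis θ i))⁻¹ := by
  have hc : ∀ i, Continuous fun θ : Fin n → ℝ => (R i * cis θ i : ℂ) := fun i =>
    continuous_const.mul ((continuous_apply i).comp continuous_cis)
  have hn : ∀ i (θ : Fin n → ℝ), ‖(R i * cis θ i : ℂ)‖ = R i := fun i θ => by
    rw [norm_mul, norm_cis, mul_one, Complex.norm_real, Real.norm_of_nonneg (hR i).le]
  refine Continuous.mul ?_ (continuous_finsetProd _ fun i _ => Continuous.inv₀ ?_ ?_)
  · rw [continuous_iff_continuousAt]
    intro θ
    exact ContinuousAt.comp (f := fun (θ : Fin n → ℝ) i => (R i * cis θ i : ℂ))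
      (hF _ fun i => (hn i θ).le).continuousAt (continuous_pi hc).continuousAt
  · exact continuous_const.sub (continuous_const.div (hc i) fun θ =>
      norm_pos_iff.1 ((hn i θ).symm ▸ hR i))
  · intro θ h0
    have h1 : ‖w i / (R i * cis θ i)‖ = 1 := by rw [← sub_eq_zero.1 h0, norm_one]
    rw [norm_div, hn, div_eq_one_iff_eq (hR i).ne'] at h1
    exact (hw i).ne h1

/-- The Cauchy integral formula on polydiscs. -/
theorem cauchy_polydisc : ∀ {n : ℕ} {F : (Fin n → ℂ) → ℂ} {R : Fin n → ℝ}, (∀ i, 0 < R i) →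
    ∀ {w : Fin n → ℂ}, (∀ i, ‖w i‖ < R i) →
    (∀ v, (∀ i, ‖v i‖ ≤ R i) → DifferentiableAt ℂ F v) →
    F w = ∫ θ, F (fun i => R i * cis θ i) * ∏ i, (1 - w i / (R i * cis θ i))⁻¹ ∂torus n
  | 0, F, R, _, w, _, _ => by
    rw [torus, Measure.pi_of_empty, integral_dirac]
    simp
    congr 1
    exact Subsingleton.elim _ _
  | n + 1, F, R, hR, w, hw, hF => by
    have hint := (continuous_cauchy_integrand hR hw hF).integrable_torus
    have mp := (measurePreserving_piFinSuccAbove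
      (fun _ : Fin (n + 1) => volume.restrict (Set.Ioc (0 : ℝ) 1)) 0).symm
    have hint' := (mp.integrable_comp_emb (MeasurableEquiv.measurableEmbedding _)).2 hint
    rw [torus, ← mp.integral_comp']
    refine Eq.trans ?_ (integral_prod _ hint').symm
    have hw' : w = Fin.cons (w 0) fun i => w i.succ := (Fin.cons_self_tail w).symm
    have hcons : ∀ (x : ℂ) (v : Fin n → ℂ), ‖x‖ ≤ R 0 → (∀ i, ‖v i‖ ≤ R i.succ) →
        DifferentiableAt ℂ F (Fin.cons x v) := by
      intro x v hx hv
      refine hF _ fun i => ?_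
      refine Fin.cases ?_ (fun i => ?_) i
      · simpa using hx
      · simpa using hv i
    -- One variable in the first coordinate, then induction in the remaining ones with the first
    -- coordinate fixed on its circle.
    have h1 := cauchy_one (f := fun x => F (Fin.cons x fun i => w i.succ)) (hR 0) (hw 0)
      fun x hx => ?_
    · conv_lhs => rw [hw', h1]
      refine integral_congr_ae (Filter.Eventually.of_forall fun t => ?_)
      have hn : ‖(R 0 * Complex.exp (2 * Real.pi * t * Complex.I) : ℂ)‖ ≤ R 0 := by
        have := norm_cis (fun _ : Fin 1 => t) 0
        rw [cis] at this
        rw [norm_mul, this, mul_one, Complex.norm_real, Real.norm_of_nonneg (hR 0).le]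
      have h2 := cauchy_polydisc (F := fun v => F (Fin.cons
        (R 0 * Complex.exp (2 * Real.pi * t * Complex.I)) v)) (fun i => hR i.succ)
        (w := fun i => w i.succ) (fun i => hw i.succ) fun v hv => ?_
      · simp only
        rw [h2, ← integral_mul_const]
        refine integral_congr_ae (Filter.Eventually.of_forall fun θ => ?_)
        have e : (fun i => (R i : ℂ) * cis ((MeasurableEquiv.piFinSuccAbove
            (fun _ : Fin (n + 1) => ℝ) 0).symm (t, θ)) i) = Fin.cons
              (R 0 * Complex.exp (2 * Real.pi * t * Complex.I)) fun i => R i.succ * cis θ i := by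
          ext i
          refine Fin.cases ?_ (fun i => ?_) i
          · simp [cis, MeasurableEquiv.piFinSuccAbove]
          · simp [cis, MeasurableEquiv.piFinSuccAbove]
        simp only [Function.comp_apply]
        rw [e, Fin.prod_univ_succ]
        simp only [congrFun e, Fin.cons_zero, Fin.cons_succ]
        ring
      · refine (hcons _ v hn hv).comp v ?_
        refine differentiableAt_pi.2 fun i => ?_
        refine Fin.cases ?_ (fun i => ?_) i
        · simp
        · simpa using differentiableAt_apply i v
    · refine (hcons x _ hx fun i => (hw i.succ).le).comp x ?_
      refine differentiableAt_pi.2 fun i => ?_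
      refine Fin.cases ?_ (fun i => ?_) i
      · simp
      · simp

theorem mpow_inv_cis (θ : Fin n → ℝ) (m : Fin n → ℕ) :
    mpow (fun i => (cis θ i)⁻¹) m = conj (mpow (cis θ) m) := by
  rw [mpow, mpow, map_prod]
  refine Finset.prod_congr rfl fun i _ => ?_
  rw [map_pow, Complex.inv_eq_conj (norm_cis θ i)]

theorem integral_mpow_cis (l m : Fin n → ℕ) :
    ∫ θ, mpow (cis θ) l * conj (mpow (cis θ) m) ∂torus n = if l = m then 1 else 0 := by
  have h1 : ∀ θ : Fin n → ℝ, mpow (cis θ) l * conj (mpow (cis θ) m)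
      = ∏ i, Complex.exp (((l i : ℤ) - m i : ℤ) * (2 * Real.pi * Complex.I) * θ i) := by
    intro θ
    rw [← mpow_inv_cis, mpow, mpow, ← Finset.prod_mul_distrib]
    refine Finset.prod_congr rfl fun i _ => ?_
    rw [cis, ← Complex.exp_neg, ← Complex.exp_nat_mul, ← Complex.exp_nat_mul, ← Complex.exp_add]
    congr 1
    push_cast
    ring
  simp only [h1]
  rw [torus, integral_fintype_prod_eq_prod
    (fun i (t : ℝ) => Complex.exp (((l i : ℤ) - m i : ℤ) * (2 * Real.pi * Complex.I) * t))]
  have h2 : ∀ k : ℤ, ∫ t in Set.Ioc (0 : ℝ) 1, Complex.exp (k * (2 * Real.pi * Complex.I) * t)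
      = if k = 0 then 1 else 0 := by
    intro k
    rw [← intervalIntegral.integral_of_le zero_le_one]
    split_ifs with hk
    · simp [hk]
    · have hk' : (k : ℂ) * (2 * Real.pi * Complex.I) ≠ 0 :=
        mul_ne_zero (by exact_mod_cast hk) Complex.two_pi_I_ne_zero
      rw [integral_exp_mul_complex hk']
      simp [Complex.exp_int_mul_two_pi_mul_I]
  simp only [h2]
  split_ifs with h
  · exact Finset.prod_eq_one fun i _ => by simp [h]
  · obtain ⟨i, hi⟩ := Function.ne_iff.1 h
    exact Finset.prod_eq_zero (Finset.mem_univ i) (if_neg (by omega))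

/-- The Fourier coefficients of a power series on a torus. -/
theorem integral_powerSeries_cis {F : (Fin n → ℂ) → ℂ} {a : (Fin n → ℕ) → ℂ} {v : Fin n → ℂ}
    (h : ∀ θ, HasSum (fun l => a l * mpow (fun i => cis θ i * v i) l) (F fun i => cis θ i * v i))
    (m : Fin n → ℕ) :
    ∫ θ, F (fun i => cis θ i * v i) * conj (mpow (cis θ) m) ∂torus n = a m * mpow v m := by
  have hc : ∀ l, Continuous fun θ : Fin n → ℝ => mpow (cis θ) l := fun l =>
    continuous_finsetProd _ fun i _ => ((continuous_apply i).comp continuous_cis).pow _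
  have hn : ∀ l (θ : Fin n → ℝ), ‖mpow (cis θ) l‖ = 1 := fun l θ => by
    simp [norm_cis, mpow]
  have hs : Summable fun l => ‖a l * mpow v l‖ := by
    have := (h 0).summable.norm
    simpa [cis] using this
  -- Termwise integration is allowed because the characters are unimodular: the norm of each term
  -- does not depend on `θ`.
  have key := hasSum_integral_of_summable_integral_norm (μ := torus n)
    (F := fun l θ => a l * mpow v l * (mpow (cis θ) l * conj (mpow (cis θ) m)))
    (fun l => (continuous_const.mul
      ((hc l).mul (Complex.continuous_conj.comp (hc m)))).integrable_torus) (by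
      simpa only [norm_mul, RCLike.norm_conj, hn, mul_one, integral_const, probReal_univ,
        one_smul] using hs)
  have e : ∀ θ, ∑' l, a l * mpow v l * (mpow (cis θ) l * conj (mpow (cis θ) m))
      = F (fun i => cis θ i * v i) * conj (mpow (cis θ) m) := by
    intro θ
    rw [← ((h θ).mul_right _).tsum_eq]
    refine tsum_congr fun l => ?_
    rw [mpow_mul]
    ring
  simp only [e, integral_const_mul, integral_mpow_cis] at key
  have h1 : HasSum (fun l => a l * mpow v l * if l = m then 1 else 0)
      (a m * mpow v m * if m = m then 1 else 0) :=
    hasSum_single m fun l hl => by simp [hl]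
  simpa using key.unique h1

/-- Power series expansion on a polydisc. -/
theorem hasSum_powerSeries_polydisc {F : (Fin n → ℂ) → ℂ} {R : Fin n → ℝ} (hR : ∀ i, 0 < R i)
    (hF : ∀ v, (∀ i, ‖v i‖ ≤ R i) → DifferentiableAt ℂ F v) :
    ∃ a : (Fin n → ℕ) → ℂ, ∀ w : Fin n → ℂ, (∀ i, ‖w i‖ < R i) →
      HasSum (fun m => a m * mpow w m) (F w) := by
  have hn : ∀ i (θ : Fin n → ℝ), ‖(R i * cis θ i : ℂ)‖ = R i := fun i θ => by
    rw [norm_mul, norm_cis, mul_one, Complex.norm_real, Real.norm_of_nonneg (hR i).le]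
  have hne : ∀ i (θ : Fin n → ℝ), (R i * cis θ i : ℂ) ≠ 0 := fun i θ =>
    norm_pos_iff.1 ((hn i θ).symm ▸ hR i)
  have hcc : ∀ i, Continuous fun θ : Fin n → ℝ => (R i * cis θ i : ℂ) := fun i =>
    continuous_const.mul ((continuous_apply i).comp continuous_cis)
  have hcF : Continuous fun θ : Fin n → ℝ => F fun i => R i * cis θ i := by
    rw [continuous_iff_continuousAt]
    intro θ
    exact ContinuousAt.comp (f := fun (θ : Fin n → ℝ) i => (R i * cis θ i : ℂ))
      (hF _ fun i => (hn i θ).le).continuousAt (continuous_pi hcc).continuousAt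
  refine ⟨fun m => ∫ θ, F (fun i => R i * cis θ i) * mpow (fun i => (R i * cis θ i)⁻¹) m ∂torus n,
    fun w hw => ?_⟩
  rw [cauchy_polydisc hR hw hF]
  have hq : ∀ i (θ : Fin n → ℝ), ‖w i / (R i * cis θ i)‖ < 1 := fun i θ => by
    rw [norm_div, hn, div_lt_one (hR i)]
    exact hw i
  have hsum : Summable fun m : Fin n → ℕ => mpow (fun i => ‖w i‖ / R i) m :=
    (summable_norm_mpow (x := fun i => ‖w i‖ / R i) fun i => by
      rw [Real.norm_of_nonneg (div_nonneg (norm_nonneg _) (hR i).le), div_lt_one (hR i)]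
      exact hw i).of_norm
  -- The Cauchy kernel is expanded as a multiple geometric series and integrated termwise; on the
  -- torus the norm of its `m`-th term is `∏ (‖wᵢ‖ / Rᵢ) ^ mᵢ`, independent of `θ`.
  have key := hasSum_integral_of_summable_integral_norm (μ := torus n)
    (F := fun m θ => F (fun i => R i * cis θ i) * mpow (fun i => w i / (R i * cis θ i)) m)
    (fun m => (hcF.mul (continuous_finsetProd _ fun i _ =>
      (continuous_const.div (hcc i) (hne i)).pow _)).integrable_torus) (by
      simp only [norm_mul, norm_mpow, norm_div, hn]
      simp only [integral_mul_const]
      exact hsum.mul_left _)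
  convert! key using 1
  · ext m
    rw [← integral_mul_const]
    refine integral_congr_ae (Filter.Eventually.of_forall fun θ => ?_)
    simp only [div_eq_mul_inv, mpow_mul]
    ring
  · refine integral_congr_ae (Filter.Eventually.of_forall fun θ => ?_)
    simp only
    rw [((hasSum_mpow fun i => hq i θ).mul_left _).tsum_eq]

end Torus

/-! ### The Bergman kernel of a Reinhardt domain -/

section Reinhardt

variable {n : ℕ}

/-- Bounded complete Reinhardt domains. -/
structure IsBoundedReinhardt (Ω : Set (Fin n → ℂ)) : Prop where
  isOpen : IsOpen Ω
  isBounded : Bornology.IsBounded Ω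
  zero_mem : (0 : Fin n → ℂ) ∈ Ω
  mem_of_le : ∀ w ∈ Ω, ∀ v : Fin n → ℂ, (∀ i, ‖v i‖ ≤ ‖w i‖) → v ∈ Ω

/-- The squared `L²` norm of a monomial. -/
noncomputable def monomialNormSq (Ω : Set (Fin n → ℂ)) (m : Fin n → ℕ) : ℝ :=
  ∫ w in Ω, ‖mpow w m‖ ^ 2

variable {Ω : Set (Fin n → ℂ)}

theorem IsBoundedReinhardt.exists_polyradius (hΩ : IsBoundedReinhardt Ω) {w : Fin n → ℂ}
    (hw : w ∈ Ω) : ∃ R : Fin n → ℝ, (∀ i, ‖w i‖ < R i) ∧ (fun i => (R i : ℂ)) ∈ Ω := by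
  have h1 : (fun i => (‖w i‖ : ℂ)) ∈ Ω := hΩ.mem_of_le w hw _ fun i => by simp
  obtain ⟨ε, hε, hball⟩ := Metric.isOpen_iff.1 hΩ.isOpen _ h1
  refine ⟨fun i => ‖w i‖ + ε / 2, fun i => by linarith, hball ?_⟩
  rw [Metric.mem_ball, dist_pi_lt_iff hε]
  intro i
  rw [Complex.dist_eq]
  push_cast
  rw [add_sub_cancel_left, ← Complex.ofReal_ofNat, ← Complex.ofReal_div, Complex.norm_real,
    Real.norm_of_nonneg (by positivity)]
  linarith

theorem IsBoundedReinhardt.mem_of_le_real (hΩ : IsBoundedReinhardt Ω) {R : Fin n → ℝ}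
    (hR : (fun i => (R i : ℂ)) ∈ Ω) {v : Fin n → ℂ} (hv : ∀ i, ‖v i‖ ≤ R i) : v ∈ Ω :=
  hΩ.mem_of_le _ hR v fun i => by
    rw [Complex.norm_real]
    exact (hv i).trans (le_abs_self _)

/-- The domain is a union of polydiscs about the origin, each with its own expansion. Any two
expansions have the same Fourier coefficients on a small common torus, so they coincide. -/
theorem IsBoundedReinhardt.exists_powerSeries (hΩ : IsBoundedReinhardt Ω) {F : (Fin n → ℂ) → ℂ}
    (hF : DifferentiableOn ℂ F Ω) :
    ∃ a : (Fin n → ℕ) → ℂ, ∀ w ∈ Ω, HasSum (fun m => a m * mpow w m) (F w) := by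
  have hloc : ∀ R : Fin n → ℝ, (∀ i, 0 < R i) → (fun i => (R i : ℂ)) ∈ Ω →
      ∃ a : (Fin n → ℕ) → ℂ, ∀ w : Fin n → ℂ, (∀ i, ‖w i‖ < R i) →
        HasSum (fun m => a m * mpow w m) (F w) := fun R hR hRΩ =>
    hasSum_powerSeries_polydisc hR fun v hv => (hF v (hΩ.mem_of_le_real hRΩ hv)).differentiableAt
      (hΩ.isOpen.mem_nhds (hΩ.mem_of_le_real hRΩ hv))
  obtain ⟨R₀, h₀, h₀'⟩ := hΩ.exists_polyradius hΩ.zero_mem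
  have h₀'' : ∀ i, 0 < R₀ i := fun i => (norm_nonneg _).trans_lt (h₀ i)
  obtain ⟨a, ha⟩ := hloc R₀ h₀'' h₀'
  refine ⟨a, fun w hw => ?_⟩
  obtain ⟨R, hR, hR'⟩ := hΩ.exists_polyradius hw
  have hR'' : ∀ i, 0 < R i := fun i => (norm_nonneg _).trans_lt (hR i)
  obtain ⟨b, hb⟩ := hloc R hR'' hR'
  convert! hb w hR using 1
  ext m
  congr 1
  -- Half of the smaller radius in each coordinate: a torus inside both polydiscs, with nonzero
  -- coordinates so that `v ^ m` can be cancelled.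
  set v : Fin n → ℂ := fun i => ((min (R i) (R₀ i) / 2 : ℝ) : ℂ) with hv
  have hmin : ∀ i, 0 < min (R i) (R₀ i) := fun i => lt_min (hR'' i) (h₀'' i)
  have hvn : ∀ i, ‖v i‖ = min (R i) (R₀ i) / 2 := fun i => by
    rw [hv, Complex.norm_real, Real.norm_of_nonneg (half_pos (hmin i)).le]
  have hrot : ∀ (θ : Fin n → ℝ) i, ‖cis θ i * v i‖ = min (R i) (R₀ i) / 2 := fun θ i => by
    rw [norm_mul, norm_cis, one_mul, hvn]
  have e1 := integral_powerSeries_cis (F := F) (v := v) (fun θ => ha _ fun i => by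
    rw [hrot]
    linarith [hmin i, min_le_right (R i) (R₀ i)]) m
  have e2 := integral_powerSeries_cis (F := F) (v := v) (fun θ => hb _ fun i => by
    rw [hrot]
    linarith [hmin i, min_le_left (R i) (R₀ i)]) m
  refine mul_right_cancel₀ ?_ (e1.symm.trans e2)
  exact Finset.prod_ne_zero_iff.2 fun i _ => pow_ne_zero _
    (norm_pos_iff.1 (by rw [hvn]; exact half_pos (hmin i)))

theorem continuous_mpow (m : Fin n → ℕ) : Continuous fun w : Fin n → ℂ => mpow w m :=
  continuous_finsetProd _ fun i _ => (continuous_apply i).pow _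

theorem differentiable_mpow (m : Fin n → ℕ) : Differentiable ℂ fun w : Fin n → ℂ => mpow w m := by
  unfold mpow
  fun_prop

theorem IsBoundedReinhardt.volume_lt_top (hΩ : IsBoundedReinhardt Ω) : volume Ω < ⊤ :=
  hΩ.isBounded.measure_lt_top

theorem IsBoundedReinhardt.memLp_mpow (hΩ : IsBoundedReinhardt Ω) (m : Fin n → ℕ) :
    MemLp (fun w : Fin n → ℂ => mpow w m) 2 (volume.restrict Ω) := by
  have : IsFiniteMeasure (volume.restrict Ω) := ⟨by simpa using hΩ.volume_lt_top⟩
  obtain ⟨C, hC⟩ := hΩ.isBounded.exists_norm_le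
  refine MemLp.of_bound (continuous_mpow m).aestronglyMeasurable (mpow (fun _ => C) m) ?_
  refine ae_restrict_of_forall_mem hΩ.isOpen.measurableSet fun w hw => ?_
  rw [norm_mpow]
  exact mpow_le_mpow (fun _ => norm_nonneg _) (fun i => (norm_le_pi_norm w i).trans (hC w hw)) m

theorem measurePreserving_rotation (θ : Fin n → ℝ) :
    MeasurePreserving (fun (w : Fin n → ℂ) i => cis θ i * w i) volume volume := by
  refine volume_preserving_pi (f := fun i (x : ℂ) => cis θ i * x) fun i => ?_
  have := (rotation ⟨cis θ i, by simp [Submonoid.unitSphere, norm_cis]⟩).measurePreserving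
  exact this

theorem IsBoundedReinhardt.preimage_rotation (hΩ : IsBoundedReinhardt Ω) (θ : Fin n → ℝ) :
    (fun (w : Fin n → ℂ) i => cis θ i * w i) ⁻¹' Ω = Ω := by
  ext w
  refine ⟨fun h => hΩ.mem_of_le _ h _ fun i => ?_, fun h => hΩ.mem_of_le _ h _ fun i => ?_⟩ <;>
  simp [norm_cis]

theorem IsBoundedReinhardt.measurePreserving_restrict (hΩ : IsBoundedReinhardt Ω)
    (θ : Fin n → ℝ) : MeasurePreserving (fun (w : Fin n → ℂ) i => cis θ i * w i)
      (volume.restrict Ω) (volume.restrict Ω) := by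
  have h := (measurePreserving_rotation θ).restrict_preimage hΩ.isOpen.measurableSet
  rwa [hΩ.preimage_rotation] at h

/-- Averaging over the torus. -/
theorem IsBoundedReinhardt.integral_eq_integral_torus (hΩ : IsBoundedReinhardt Ω)
    {H : (Fin n → ℂ) → ℂ} (hc : ContinuousOn H Ω) (hi : IntegrableOn H Ω) :
    ∫ w in Ω, H w = ∫ w in Ω, ∫ θ, H (fun i => cis θ i * w i) ∂torus n := by
  have hrot : ∀ θ : Fin n → ℝ, ∫ w in Ω, H (fun i => cis θ i * w i) = ∫ w in Ω, H w := by
    intro θ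
    have mp := hΩ.measurePreserving_restrict θ
    conv_rhs => rw [← mp.map_eq]
    rw [integral_map mp.measurable.aemeasurable]
    rw [mp.map_eq]
    exact hi.aestronglyMeasurable
  have hrot' : ∀ θ : Fin n → ℝ, ∫ w in Ω, ‖H (fun i => cis θ i * w i)‖ = ∫ w in Ω, ‖H w‖ := by
    intro θ
    have mp := hΩ.measurePreserving_restrict θ
    conv_rhs => rw [← mp.map_eq]
    rw [integral_map mp.measurable.aemeasurable]
    rw [mp.map_eq]
    exact hi.aestronglyMeasurable.norm
  have hmeas : AEStronglyMeasurable (Function.uncurry fun (θ : Fin n → ℝ) (w : Fin n → ℂ) =>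
      H (fun i => cis θ i * w i)) ((torus n).prod (volume.restrict Ω)) := by
    have hcont : ContinuousOn (Function.uncurry fun (θ : Fin n → ℝ) (w : Fin n → ℂ) =>
        H (fun i => cis θ i * w i)) (Set.univ ×ˢ Ω) := by
      refine hc.comp (Continuous.continuousOn ?_) fun p hp => ?_
      · exact continuous_pi fun i => ((continuous_apply i).comp (continuous_cis.comp
          continuous_fst)).mul ((continuous_apply i).comp continuous_snd)
      · exact hΩ.mem_of_le _ hp.2 _ fun i => by simp [norm_cis]
    have := hcont.aestronglyMeasurable (μ := (torus n).prod volume)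
      (MeasurableSet.univ.prod hΩ.isOpen.measurableSet)
    rwa [← Measure.prod_restrict, Measure.restrict_univ] at this
  have hint : Integrable (Function.uncurry fun (θ : Fin n → ℝ) (w : Fin n → ℂ) =>
      H (fun i => cis θ i * w i)) ((torus n).prod (volume.restrict Ω)) := by
    rw [integrable_prod_iff hmeas]
    refine ⟨Filter.Eventually.of_forall fun θ => ?_, ?_⟩
    · exact (hΩ.measurePreserving_restrict θ).integrable_comp_of_integrable hi
    · simp only [Function.uncurry_apply_pair, hrot']
      exact integrable_const _
  rw [← integral_integral_swap hint]
  simp [hrot]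

/-- Averaging over the torus first replaces the integrand at each `w` by `a m * |w^m|²`. The power
series is thus never integrated over the domain, where its convergence is only pointwise. -/
theorem IsBoundedReinhardt.integral_conj_mpow_mul (hΩ : IsBoundedReinhardt Ω)
    {F : (Fin n → ℂ) → ℂ} (hF : MemLp F 2 (volume.restrict Ω)) (hc : ContinuousOn F Ω)
    {a : (Fin n → ℕ) → ℂ} (ha : ∀ w ∈ Ω, HasSum (fun m => a m * mpow w m) (F w))
    (m : Fin n → ℕ) :
    ∫ w in Ω, conj (mpow w m) * F w = a m * monomialNormSq Ω m := by
  have hi : IntegrableOn (fun w => conj (mpow w m) * F w) Ω :=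
    MemLp.integrable_mul (hΩ.memLp_mpow m).star hF
  have hcH : ContinuousOn (fun w => conj (mpow w m) * F w) Ω :=
    (Complex.continuous_conj.comp (continuous_mpow m)).continuousOn.mul hc
  rw [hΩ.integral_eq_integral_torus hcH hi, monomialNormSq, ← integral_complex_ofReal, ← integral_const_mul]
  refine setIntegral_congr_fun hΩ.isOpen.measurableSet fun w hw => ?_
  have h := integral_powerSeries_cis (F := F) (v := w) (fun θ => ha _
    (hΩ.mem_of_le _ hw _ fun i => by simp [norm_cis])) m
  have e : ∀ θ : Fin n → ℝ, conj (mpow (fun i => cis θ i * w i) m) * F (fun i => cis θ i * w i)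
      = conj (mpow w m) * (F (fun i => cis θ i * w i) * conj (mpow (cis θ) m)) := by
    intro θ
    rw [mpow_mul, map_mul]
    ring
  simp only [e, integral_const_mul, h]
  push_cast
  rw [← Complex.conj_mul']
  ring

theorem IsBoundedReinhardt.integral_conj_mpow_mul_mpow (hΩ : IsBoundedReinhardt Ω)
    (l m : Fin n → ℕ) :
    ∫ w in Ω, conj (mpow w l) * mpow w m = if l = m then (monomialNormSq Ω m : ℂ) else 0 := by
  rw [hΩ.integral_conj_mpow_mul (a := fun k => if k = m then 1 else 0) (hΩ.memLp_mpow m)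
    (continuous_mpow m).continuousOn fun w _ => ?_]
  · split_ifs with h <;> simp [h]
  · simpa using hasSum_single (f := fun k => (if k = m then 1 else 0) * mpow w k) m
      fun k hk => by simp [hk]

/-- The part of the domain lying strictly beyond the polyradius `R` is open and nonempty, and there
`|w^m|² ≥ R^(2m)`. This lower bound controls both the growth of the kernel coefficients and the
convergence of the kernel series. -/
theorem IsBoundedReinhardt.le_monomialNormSq (hΩ : IsBoundedReinhardt Ω) {R : Fin n → ℝ}
    (hR : (fun i => (R i : ℂ)) ∈ Ω) (hR0 : ∀ i, 0 ≤ R i) :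
    ∃ v : ℝ, 0 < v ∧ ∀ m, v * mpow (fun i => R i ^ 2) m ≤ monomialNormSq Ω m := by
  set A : Set (Fin n → ℂ) := Ω ∩ {w | ∀ i, R i < ‖w i‖} with hA
  have hAo : IsOpen A := by
    refine hΩ.isOpen.inter ?_
    rw [Set.ofPred_forall]
    exact isOpen_iInter_of_finite fun i => isOpen_lt continuous_const (continuous_apply i).norm
  have hAne : A.Nonempty := by
    obtain ⟨R', h1, h2⟩ := hΩ.exists_polyradius hR
    refine ⟨_, h2, fun i => ?_⟩
    rw [Complex.norm_real]
    refine lt_of_lt_of_le ?_ (le_abs_self _)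
    simpa [abs_of_nonneg (hR0 i)] using h1 i
  have hAt : volume A < ⊤ := (measure_mono Set.inter_subset_left).trans_lt hΩ.volume_lt_top
  refine ⟨volume.real A, ENNReal.toReal_pos (hAo.measure_pos _ hAne).ne' hAt.ne, fun m => ?_⟩
  have hint : IntegrableOn (fun w => ‖mpow w m‖ ^ 2) Ω := (hΩ.memLp_mpow m).integrable_norm_pow
    (by norm_num)
  have h1 : ∫ w in A, ‖mpow w m‖ ^ 2 ≤ monomialNormSq Ω m :=
    setIntegral_mono_set hint (Filter.Eventually.of_forall fun w => sq_nonneg _)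
      (Filter.Eventually.of_forall fun w hw => hw.1)
  refine le_trans ?_ h1
  rw [← smul_eq_mul, ← setIntegral_const]
  refine setIntegral_mono_on (integrableOn_const hAt.ne) (hint.mono_set Set.inter_subset_left)
    hAo.measurableSet fun w hw => ?_
  have e : mpow (fun i => R i ^ 2) m = (mpow R m) ^ 2 := by
    rw [mpow, mpow, ← Finset.prod_pow]
    exact Finset.prod_congr rfl fun i _ => pow_right_comm _ _ _
  rw [e, norm_mpow]
  exact pow_le_pow_left₀ (mpow_nonneg hR0 m) (mpow_le_mpow hR0 (fun i => (hw.2 i).le) m) 2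

theorem IsBoundedReinhardt.monomialNormSq_pos (hΩ : IsBoundedReinhardt Ω) (m : Fin n → ℕ) :
    0 < monomialNormSq Ω m := by
  obtain ⟨R, h1, h2⟩ := hΩ.exists_polyradius hΩ.zero_mem
  have h3 : ∀ i, 0 < R i := fun i => (norm_nonneg _).trans_lt (h1 i)
  obtain ⟨v, hv, h⟩ := hΩ.le_monomialNormSq h2 fun i => (h3 i).le
  exact (mul_pos hv (mpow_pos (fun i => pow_pos (h3 i) 2) m)).trans_le (h m)

theorem IsBoundedReinhardt.geomBounded (hΩ : IsBoundedReinhardt Ω) :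
    GeomBounded fun m => (monomialNormSq Ω m)⁻¹ := by
  obtain ⟨R, h1, h2⟩ := hΩ.exists_polyradius hΩ.zero_mem
  have h3 : ∀ i, 0 < R i := fun i => (norm_nonneg _).trans_lt (h1 i)
  obtain ⟨v, hv, h⟩ := hΩ.le_monomialNormSq h2 fun i => (h3 i).le
  obtain ⟨ρ, hρ, hρ'⟩ : ∃ ρ : ℝ, 0 < ρ ∧ ∀ i, ρ ≤ R i ^ 2 := by
    rcases isEmpty_or_nonempty (Fin n) with hn | hn
    · exact ⟨1, one_pos, fun i => isEmptyElim i⟩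
    · obtain ⟨j, hj⟩ := Finite.exists_min fun i => R i ^ 2
      exact ⟨R j ^ 2, pow_pos (h3 j) 2, hj⟩
  refine ⟨v⁻¹, ρ, hρ, fun m => ?_⟩
  have hN := hΩ.monomialNormSq_pos m
  rw [abs_of_pos (inv_pos.2 hN), inv_mul_le_iff₀ hN, ← div_eq_mul_inv, le_div_iff₀ hv, mul_comm]
  exact (mul_le_mul_of_nonneg_left (mpow_le_mpow (fun _ => hρ.le) hρ' m) hv.le).trans (h m)

/-- A slightly larger polyradius still in the domain gives comparison with the geometric series in
`‖zᵢ‖² / Rᵢ²`. -/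
theorem IsBoundedReinhardt.summable (hΩ : IsBoundedReinhardt Ω) {z : Fin n → ℂ} (hz : z ∈ Ω) :
    Summable fun m => (monomialNormSq Ω m)⁻¹ * mpow (normSqs z) m := by
  obtain ⟨R, h1, h2⟩ := hΩ.exists_polyradius hz
  have h3 : ∀ i, 0 < R i := fun i => (norm_nonneg _).trans_lt (h1 i)
  obtain ⟨v, hv, h⟩ := hΩ.le_monomialNormSq h2 fun i => (h3 i).le
  have hq : ∀ i, 0 ≤ ‖z i‖ ^ 2 / R i ^ 2 := fun i => by positivity
  have hs : Summable fun m => v⁻¹ * mpow (fun i => ‖z i‖ ^ 2 / R i ^ 2) m := by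
    refine Summable.mul_left _ (summable_norm_mpow (x := fun i => ‖z i‖ ^ 2 / R i ^ 2)
      fun i => ?_).of_norm
    rw [Real.norm_of_nonneg (hq i), div_lt_one (pow_pos (h3 i) 2)]
    exact pow_lt_pow_left₀ (h1 i) (norm_nonneg _) two_ne_zero
  have hnn : ∀ m, 0 ≤ mpow (normSqs z) m := fun m => mpow_nonneg (fun i => Complex.normSq_nonneg _) m
  refine Summable.of_nonneg_of_le (fun m => mul_nonneg (inv_nonneg.2 (hΩ.monomialNormSq_pos m).le)
    (hnn m)) (fun m => ?_) hs
  have hR2 : 0 < mpow (fun i => R i ^ 2) m := mpow_pos (fun i => pow_pos (h3 i) 2) m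
  have e : mpow (normSqs z) m = mpow (fun i => ‖z i‖ ^ 2 / R i ^ 2) m * mpow (fun i => R i ^ 2) m := by
    rw [← mpow_mul]
    congr 1
    ext i
    rw [div_mul_cancel₀ _ (pow_pos (h3 i) 2).ne', normSqs, Complex.normSq_eq_norm_sq]
  rw [inv_mul_le_iff₀ (hΩ.monomialNormSq_pos m), e]
  have := mul_le_mul_of_nonneg_left (h m) (mul_nonneg (inv_pos.2 hv).le
    (mpow_nonneg hq m))
  calc _ = v⁻¹ * mpow (fun i => ‖z i‖ ^ 2 / R i ^ 2) m * (v * mpow (fun i => R i ^ 2) m) := by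
        field_simp
    _ ≤ _ := this
    _ = _ := by ring

end Reinhardt

/-! ### The reproducing element and independence of the orthonormal basis -/

section Kernel

open scoped InnerProductSpace

/-- Parseval's identity inside the closed span, where the family is a Hilbert basis even if it is
not one of the ambient space. -/
theorem Orthonormal.hasSum_inner_mul_inner_of_mem_closure {ι E : Type*} [NormedAddCommGroup E]
    [InnerProductSpace ℂ E] [CompleteSpace E] {v : ι → E} (hv : Orthonormal ℂ v) {x : E}
    (hx : x ∈ (Submodule.span ℂ (Set.range v)).topologicalClosure) :
    HasSum (fun i => ⟪x, v i⟫_ℂ * ⟪v i, x⟫_ℂ) ⟪x, x⟫_ℂ := by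
  set V := (Submodule.span ℂ (Set.range v)).topologicalClosure with hV
  have hmem : ∀ i, v i ∈ V := fun i =>
    Submodule.le_topologicalClosure _ (Submodule.subset_span ⟨i, rfl⟩)
  have : CompleteSpace V :=
    (Submodule.isClosed_topologicalClosure _).completeSpace_coe
  let w : ι → V := fun i => ⟨v i, hmem i⟩
  have hw : Orthonormal ℂ w := ⟨fun i => hv.1 i, fun i j hij => hv.2 hij⟩
  have hbot : (Submodule.span ℂ (Set.range w))ᗮ = ⊥ := by
    rw [eq_bot_iff]
    intro y hy
    have h1 : (y : E) ∈ (Submodule.span ℂ (Set.range v))ᗮ := by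
      rw [Submodule.mem_orthogonal]
      intro u hu
      induction hu using Submodule.span_induction with
      | mem u hu =>
        obtain ⟨i, rfl⟩ := hu
        exact (Submodule.mem_orthogonal _ _).1 hy (w i) (Submodule.subset_span ⟨i, rfl⟩)
      | zero => simp
      | add a b _ _ ha hb => rw [inner_add_left, ha, hb, add_zero]
      | smul c a _ ha => rw [inner_smul_left, ha, mul_zero]
    rw [← Submodule.orthogonal_closure] at h1
    have h2 := (Submodule.mem_orthogonal _ _).1 h1 y y.2
    rw [Submodule.mem_bot]
    exact Subtype.ext (inner_self_eq_zero.1 h2)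
  let b := HilbertBasis.mkOfOrthogonalEqBot hw hbot
  have h := b.hasSum_inner_mul_inner ⟨x, hx⟩ ⟨x, hx⟩
  have hb : ∀ i, b i = w i := fun i => by
    simp [b]
  simp only [hb] at h
  exact h

variable {n : ℕ} {Ω : Set (Fin n → ℂ)}

/-- The monomials as elements of `L²`. -/
noncomputable def IsBoundedReinhardt.monomialLp (hΩ : IsBoundedReinhardt Ω) (m : Fin n → ℕ) :
    Lp ℂ 2 (volume.restrict Ω) := (hΩ.memLp_mpow m).toLp _

theorem IsBoundedReinhardt.monomialLp_mem (hΩ : IsBoundedReinhardt Ω) (m : Fin n → ℕ) :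
    hΩ.monomialLp m ∈ bergmanSpace Ω :=
  ⟨_, (differentiable_mpow m).differentiableOn, (hΩ.memLp_mpow m).coeFn_toLp⟩

theorem IsBoundedReinhardt.inner_monomialLp (hΩ : IsBoundedReinhardt Ω)
    {f : Lp ℂ 2 (volume.restrict Ω)} {F : (Fin n → ℂ) → ℂ} (hc : ContinuousOn F Ω)
    (hf : f =ᵐ[volume.restrict Ω] F) {a : (Fin n → ℕ) → ℂ}
    (ha : ∀ w ∈ Ω, HasSum (fun m => a m * mpow w m) (F w)) (m : Fin n → ℕ) :
    ⟪hΩ.monomialLp m, f⟫_ℂ = a m * monomialNormSq Ω m := by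
  rw [← hΩ.integral_conj_mpow_mul ((memLp_congr_ae hf).1 (Lp.memLp f)) hc ha m, L2.inner_def]
  refine integral_congr_ae ?_
  filter_upwards [hf, (hΩ.memLp_mpow m).coeFn_toLp] with w h1 h2
  rw [h1, IsBoundedReinhardt.monomialLp, h2, RCLike.inner_apply, mul_comm]

theorem IsBoundedReinhardt.inner_monomialLp_monomialLp (hΩ : IsBoundedReinhardt Ω)
    (l m : Fin n → ℕ) :
    ⟪hΩ.monomialLp l, hΩ.monomialLp m⟫_ℂ = if l = m then (monomialNormSq Ω m : ℂ) else 0 := by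
  rw [← hΩ.integral_conj_mpow_mul_mpow, L2.inner_def]
  refine integral_congr_ae ?_
  filter_upwards [(hΩ.memLp_mpow l).coeFn_toLp, (hΩ.memLp_mpow m).coeFn_toLp] with w h1 h2
  rw [IsBoundedReinhardt.monomialLp, IsBoundedReinhardt.monomialLp, h1, h2, RCLike.inner_apply,
    mul_comm]

theorem IsBoundedReinhardt.orthonormal_monomialLp (hΩ : IsBoundedReinhardt Ω) :
    Orthonormal ℂ fun m => ((√(monomialNormSq Ω m))⁻¹ : ℂ) • hΩ.monomialLp m := by
  classical
  rw [orthonormal_iff_ite]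
  intro l m
  rw [inner_smul_left, inner_smul_right, hΩ.inner_monomialLp_monomialLp]
  split_ifs with h
  · subst h
    have h1 := hΩ.monomialNormSq_pos l
    have h2 : ((√(monomialNormSq Ω l) : ℝ) : ℂ) * (√(monomialNormSq Ω l) : ℝ) =
        (monomialNormSq Ω l : ℂ) := by
      rw [← Complex.ofReal_mul, Real.mul_self_sqrt h1.le]
    have h3 : ((√(monomialNormSq Ω l) : ℝ) : ℂ) ≠ 0 := by
      exact_mod_cast (Real.sqrt_pos.2 h1).ne'
    rw [map_inv₀, Complex.conj_ofReal, ← h2]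
    field_simp
  · simp

/-- The Bergman kernel at a point as an element of `L²`. -/
theorem IsBoundedReinhardt.exists_reproducing (hΩ : IsBoundedReinhardt Ω) {z : Fin n → ℂ}
    (hz : z ∈ Ω) : ∃ k : Lp ℂ 2 (volume.restrict Ω),
      k ∈ (Submodule.span ℂ (Set.range hΩ.monomialLp)).topologicalClosure ∧
      (∀ (f : Lp ℂ 2 (volume.restrict Ω)) (F : (Fin n → ℂ) → ℂ), DifferentiableOn ℂ F Ω →
        f =ᵐ[volume.restrict Ω] F → ⟪f, k⟫_ℂ = conj (F z)) ∧
      ⟪k, k⟫_ℂ = (mseries (fun m => (monomialNormSq Ω m)⁻¹) (normSqs z) : ℝ) := by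
  have hNpos := hΩ.monomialNormSq_pos
  have hsq : ∀ m, ((√(monomialNormSq Ω m) : ℝ) : ℂ)⁻¹ * ((√(monomialNormSq Ω m) : ℝ) : ℂ)⁻¹
      = (monomialNormSq Ω m : ℂ)⁻¹ := fun m => by
    rw [← mul_inv, ← Complex.ofReal_mul, Real.mul_self_sqrt (hNpos m).le]
  -- The coefficients of the kernel at `z` in the normalized monomials; their square sum is the
  -- kernel series, so the expansion converges in `L²`.
  let c : (Fin n → ℕ) → ℂ := fun m => conj (mpow z m) * ((√(monomialNormSq Ω m) : ℝ) : ℂ)⁻¹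
  have hc : Summable fun m => ‖c m‖ ^ 2 := by
    refine (hΩ.summable hz).congr fun m => ?_
    have e : ‖mpow z m‖ ^ 2 = mpow (normSqs z) m := by
      rw [norm_mpow, mpow, mpow, ← Finset.prod_pow]
      refine Finset.prod_congr rfl fun i _ => ?_
      rw [pow_right_comm, normSqs, Complex.normSq_eq_norm_sq]
    rw [norm_mul, mul_pow, RCLike.norm_conj, e, norm_inv, Complex.norm_real,
      Real.norm_of_nonneg (Real.sqrt_nonneg _), inv_pow, Real.sq_sqrt (hNpos m).le, mul_comm]
  have hsum : Summable fun m => c m • ((√(monomialNormSq Ω m) : ℝ) : ℂ)⁻¹ • hΩ.monomialLp m :=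
    hΩ.orthonormal_monomialLp.orthogonalFamily.summable_iff_norm_sq_summable c |>.2 hc
  have hk := hsum.hasSum
  set k := ∑' m, c m • ((√(monomialNormSq Ω m) : ℝ) : ℂ)⁻¹ • hΩ.monomialLp m with hkdef
  have hterm : ∀ (f : Lp ℂ 2 (volume.restrict Ω)) m,
      ⟪f, c m • ((√(monomialNormSq Ω m) : ℝ) : ℂ)⁻¹ • hΩ.monomialLp m⟫_ℂ
        = conj (mpow z m) * (monomialNormSq Ω m : ℂ)⁻¹ * ⟪f, hΩ.monomialLp m⟫_ℂ := fun f m => by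
    rw [inner_smul_right, inner_smul_right, ← hsq]
    simp only [c]
    ring
  -- The inner product passes through the sum defining `k` by continuity, and the resulting series
  -- is the conjugate of the power series of `F` at `z`. Completeness of the monomials is not
  -- needed.
  have hrep : ∀ (f : Lp ℂ 2 (volume.restrict Ω)) (F : (Fin n → ℂ) → ℂ), DifferentiableOn ℂ F Ω →
      f =ᵐ[volume.restrict Ω] F → ⟪f, k⟫_ℂ = conj (F z) := by
    intro f F hF hf
    obtain ⟨a, ha⟩ := hΩ.exists_powerSeries hF
    have h1 : HasSum _ ⟪f, k⟫_ℂ := (innerSL ℂ f).hasSum hk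
    refine h1.unique ?_
    have h2 := Complex.conjCLE.toContinuousLinearMap.hasSum (ha z hz)
    refine h2.congr_fun fun m => ?_
    have hne : (monomialNormSq Ω m : ℂ) ≠ 0 := by exact_mod_cast (hNpos m).ne'
    simp only [innerSL_apply_apply]
    rw [hterm, ← inner_conj_symm, hΩ.inner_monomialLp hF.continuousOn hf ha]
    simp only [map_mul, Complex.conj_ofReal, ContinuousLinearEquiv.coe_coe,
      Complex.conjCLE_apply]
    field_simp
  refine ⟨k, ?_, hrep, ?_⟩
  · refine mem_closure_of_tendsto hk (Filter.Eventually.of_forall fun s => ?_)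
    exact Submodule.sum_mem _ fun m _ => Submodule.smul_mem _ _
      (Submodule.smul_mem _ _ (Submodule.subset_span ⟨m, rfl⟩))
  · have h1 : HasSum _ ⟪k, k⟫_ℂ := (innerSL ℂ k).hasSum hk
    refine h1.unique ?_
    have h2 := Complex.ofRealCLM.hasSum (hΩ.summable hz).hasSum
    refine h2.congr_fun fun m => ?_
    simp only [innerSL_apply_apply]
    rw [hterm, ← inner_conj_symm, hrep (hΩ.monomialLp m) _ (differentiable_mpow m).differentiableOn
      (hΩ.memLp_mpow m).coeFn_toLp, Complex.conj_conj]
    have e : ((mpow (normSqs z) m : ℝ) : ℂ) = conj (mpow z m) * mpow z m := by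
      rw [mpow, mpow, map_prod, ← Finset.prod_mul_distrib, Complex.ofReal_prod]
      refine Finset.prod_congr rfl fun i _ => ?_
      rw [normSqs, Complex.ofReal_pow, Complex.normSq_eq_conj_mul_self, mul_pow, map_pow]
    simp only [Complex.ofRealCLM_apply, Complex.ofReal_mul, Complex.ofReal_inv, e]
    ring

/-- The Bergman kernel of a bounded complete Reinhardt domain on the diagonal. -/
theorem IsBoundedReinhardt.bergmanKernel_self (hΩ : IsBoundedReinhardt Ω) {z : Fin n → ℂ}
    (hz : z ∈ Ω) : bergmanKernel Ω z z
      = (mseries (fun m => (monomialNormSq Ω m)⁻¹) (normSqs z) : ℝ) := by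
  obtain ⟨k, hk, hrep, hkk⟩ := hΩ.exists_reproducing hz
  obtain ⟨hort, hdense⟩ : IsBergmanBasis Ω (bergmanBasis Ω) :=
    Classical.choose_spec (exists_isBergmanBasis Ω)
  have hv : Orthonormal ℂ fun e : bergmanBasis Ω =>
      ((e : bergmanSpace Ω) : Lp ℂ 2 (volume.restrict Ω)) :=
    hort.comp_linearIsometry (bergmanSpace Ω).subtypeₗᵢ
  have hspan : ∀ x ∈ Submodule.span ℂ (bergmanBasis Ω), (x : Lp ℂ 2 (volume.restrict Ω)) ∈
      Submodule.span ℂ (Set.range fun e : bergmanBasis Ω =>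
        ((e : bergmanSpace Ω) : Lp ℂ 2 (volume.restrict Ω))) := by
    intro x hx
    have h := Submodule.mem_map_of_mem (f := (bergmanSpace Ω).subtype) hx
    rw [Submodule.map_span] at h
    refine Submodule.span_mono ?_ h
    rintro _ ⟨e, he, rfl⟩
    exact ⟨⟨e, he⟩, rfl⟩
  have hmem : ∀ x : bergmanSpace Ω, (x : Lp ℂ 2 (volume.restrict Ω)) ∈
      (Submodule.span ℂ (Set.range fun e : bergmanBasis Ω =>
        ((e : bergmanSpace Ω) : Lp ℂ 2 (volume.restrict Ω)))).topologicalClosure := fun x =>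
    map_mem_closure continuous_subtype_val
      ((Submodule.dense_iff_topologicalClosure_eq_top.2 hdense) x) hspan
  -- The monomials belong to the Bergman space, hence to the closed span of the chosen basis, and
  -- `k` lies in their closed span.
  have hk' : k ∈ (Submodule.span ℂ (Set.range fun e : bergmanBasis Ω =>
      ((e : bergmanSpace Ω) : Lp ℂ 2 (volume.restrict Ω)))).topologicalClosure := by
    refine Submodule.topologicalClosure_minimal _ ?_ (Submodule.isClosed_topologicalClosure _) hk
    rw [Submodule.span_le]
    rintro _ ⟨m, rfl⟩
    exact hmem ⟨_, hΩ.monomialLp_mem m⟩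
  -- By the reproducing property the Parseval terms of `k` are `|e(z)|²`, so the kernel sum for this
  -- basis is `‖k‖²`, already computed from monomials.
  have h := hv.hasSum_inner_mul_inner_of_mem_closure hk'
  rw [← hkk, ← h.tsum_eq, bergmanKernel]
  refine tsum_congr fun e => ?_
  obtain ⟨h1, h2⟩ := holoRep_spec (e : bergmanSpace Ω)
  rw [← inner_conj_symm, hrep _ _ h1 h2, Complex.conj_conj]

end Kernel

/-! ### The domains `E_{p,λ}` -/

section DomainE

variable {p lam : ℝ}

theorem isBoundedReinhardt_domainE (hp : 0 < p) (hlam : 0 < lam) :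
    IsBoundedReinhardt (domainE p lam) where
  isOpen := by
    refine isOpen_lt ?_ continuous_const
    have h : ∀ i : Fin 3, Continuous fun v : Fin 3 → ℂ => ‖v i‖ := fun i =>
      (continuous_apply i).norm
    exact ((((h 0).rpow_const fun _ => Or.inr (by positivity)).add ((h 1).pow 2)).rpow_const
      fun _ => Or.inr (by positivity)).add ((h 2).pow 2)
  isBounded := by
    refine (Metric.isBounded_closedBall (x := (0 : Fin 3 → ℂ)) (r := 1)).subset fun v hv => ?_
    rw [mem_closedBall_zero_iff, pi_norm_le_iff_of_nonneg zero_le_one]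
    have hv : (‖v 0‖ ^ (2 * p) + ‖v 1‖ ^ 2) ^ (1 / lam) + ‖v 2‖ ^ 2 < 1 := hv
    have h0 : 0 ≤ ‖v 0‖ ^ (2 * p) := by positivity
    have h1 : (‖v 0‖ ^ (2 * p) + ‖v 1‖ ^ 2) ^ (1 / lam) < 1 := by nlinarith [sq_nonneg ‖v 2‖]
    have h2 : 0 ≤ (‖v 0‖ ^ (2 * p) + ‖v 1‖ ^ 2) ^ (1 / lam) := by positivity
    have h3 : ‖v 0‖ ^ (2 * p) + ‖v 1‖ ^ 2 < 1 := by
      by_contra! hcon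
      exact absurd (Real.one_le_rpow hcon (by positivity)) (not_le.2 h1)
    have h4 : ‖v 0‖ ≤ 1 := by
      by_contra! hcon
      have := Real.one_lt_rpow hcon (by positivity : 0 < 2 * p)
      nlinarith [sq_nonneg ‖v 1‖]
    intro i
    fin_cases i
    · exact h4
    · change ‖v 1‖ ≤ 1
      nlinarith
    · change ‖v 2‖ ≤ 1
      nlinarith
  zero_mem := by
    change (_ : ℝ) < 1
    rw [Pi.zero_apply, Pi.zero_apply, Pi.zero_apply, norm_zero, Real.zero_rpow (by positivity)]
    norm_num
    rw [Real.zero_rpow (by positivity)]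
    exact one_pos
  mem_of_le w hw v h := by
    have hw : (‖w 0‖ ^ (2 * p) + ‖w 1‖ ^ 2) ^ (1 / lam) + ‖w 2‖ ^ 2 < 1 := hw
    refine lt_of_le_of_lt (b := (‖w 0‖ ^ (2 * p) + ‖w 1‖ ^ 2) ^ (1 / lam) + ‖w 2‖ ^ 2) ?_ hw
    have := h 0
    have := h 1
    have := h 2
    gcongr

/-- The disc `|z|² ≤ b` has area `πb`, so area pushes forward to `π` times length. -/
theorem map_normSq_volume : Measure.map Complex.normSq volume
    = NNReal.pi • volume.restrict (Set.Ioi (0 : ℝ)) := by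
  have hpi : ENNReal.ofReal Real.pi = NNReal.pi := by
    rw [← NNReal.coe_real_pi, ENNReal.ofReal_coe_nnreal]
  have hIic : ∀ b : ℝ, volume (Complex.normSq ⁻¹' Set.Iic b) = ENNReal.ofReal (Real.pi * b) := by
    intro b
    rcases lt_or_ge b 0 with hb | hb
    · have : Complex.normSq ⁻¹' Set.Iic b = ∅ := by
        ext z
        simpa using hb.trans_le (Complex.normSq_nonneg z)
      rw [this, measure_empty, ENNReal.ofReal_of_nonpos (by nlinarith [Real.pi_pos])]
    · have : Complex.normSq ⁻¹' Set.Iic b = Metric.closedBall 0 (√b) := by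
        ext z
        rw [Set.mem_preimage, Set.mem_Iic, mem_closedBall_zero_iff, Complex.normSq_eq_norm_sq,
          Real.le_sqrt (norm_nonneg _) hb]
      rw [this, Complex.volume_closedBall, ← ENNReal.ofReal_pow (Real.sqrt_nonneg b),
        Real.sq_sqrt hb, mul_comm, ENNReal.ofReal_mul Real.pi_pos.le, hpi]
  symm
  refine Measure.ext_of_Ioc _ _ fun a b hab => ?_
  have hm : Measurable Complex.normSq := Complex.continuous_normSq.measurable
  rw [Measure.map_apply hm measurableSet_Ioc, ← Set.Iic_sdiff_Iic, Set.preimage_sdiff,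
    measure_sdiff (Set.preimage_mono (Set.Iic_subset_Iic.2 hab.le))
      (hm measurableSet_Iic).nullMeasurableSet (by rw [hIic]; exact ENNReal.ofReal_ne_top),
    hIic, hIic, Measure.smul_apply, ENNReal.smul_def, smul_eq_mul, ← hpi, Set.Iic_sdiff_Iic,
    Measure.restrict_apply measurableSet_Ioc, Set.Ioc_inter_Ioi, Real.volume_Ioc,
    ← ENNReal.ofReal_mul Real.pi_pos.le]
  rcases le_or_gt a 0 with ha | ha
  · rw [max_eq_right ha, ENNReal.ofReal_of_nonpos (p := Real.pi * a) (by nlinarith [Real.pi_pos]),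
      sub_zero, tsub_zero]
  · rw [max_eq_left ha.le, ← ENNReal.ofReal_sub _ (by positivity), mul_sub]

/-- The integration order, with `r` innermost and `t` outermost, is the one in which the inequality
defining the domain is solved. -/
theorem lintegral_comp_normSqs {g : (Fin 3 → ℝ) → ENNReal} (hg : Measurable g) :
    ∫⁻ w : Fin 3 → ℂ, g (normSqs w) = ENNReal.ofReal (Real.pi ^ 3) *
      ∫⁻ t in Set.Ioi (0 : ℝ), ∫⁻ s in Set.Ioi (0 : ℝ), ∫⁻ r in Set.Ioi (0 : ℝ), g ![r, s, t] := by
  set μ := NNReal.pi • volume.restrict (Set.Ioi (0 : ℝ)) with hμ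
  have hmp : MeasurePreserving (normSqs (n := 3)) volume (Measure.pi fun _ => μ) :=
    measurePreserving_pi (fun _ => volume) (fun _ => μ) fun _ =>
      ⟨Complex.continuous_normSq.measurable, map_normSq_volume⟩
  rw [hmp.lintegral_comp hg,
    ← (measurePreserving_piFinSuccAbove (fun _ : Fin 3 => μ) 0).symm.lintegral_comp hg]
  refine (lintegral_prod_symm _ (hg.comp (MeasurableEquiv.measurable _)).aemeasurable).trans ?_
  have hg' : Measurable fun v : Fin 2 → ℝ => ∫⁻ r, g (Fin.cons r v) ∂μ := by
    refine Measurable.lintegral_prod_left' (f := fun q : ℝ × (Fin 2 → ℝ) => g (Fin.cons q.1 q.2)) ?_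
    refine hg.comp ?_
    refine measurable_pi_iff.2 fun i => ?_
    refine Fin.cases ?_ (fun i => ?_) i
    · simpa using measurable_fst
    · simp only [Fin.cons_succ]
      exact (measurable_pi_apply i).comp measurable_snd
  have hcons : ∀ (r : ℝ) (v : Fin 2 → ℝ),
      (MeasurableEquiv.piFinSuccAbove (fun _ : Fin 3 => ℝ) 0).symm (r, v) = Fin.cons r v := by
    intro r v
    ext i
    refine Fin.cases ?_ (fun i => ?_) i <;> simp [MeasurableEquiv.piFinSuccAbove]
  simp only [Function.comp_apply, hcons]
  rw [← (measurePreserving_finTwoArrow μ).symm.lintegral_comp hg']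
  refine (lintegral_prod_symm _ (hg'.comp (MeasurableEquiv.measurable _)).aemeasurable).trans ?_
  change ∫⁻ t, ∫⁻ s, ∫⁻ r, g ![r, s, t] ∂μ ∂μ ∂μ = _
  simp only [hμ, lintegral_smul_measure, ENNReal.smul_def, smul_eq_mul,
    lintegral_const_mul' _ _ ENNReal.coe_ne_top]
  rw [← mul_assoc, ← mul_assoc]
  congr 1
  rw [ENNReal.ofReal_pow Real.pi_pos.le, ← NNReal.coe_real_pi, ENNReal.ofReal_coe_nnreal]
  ring

/-- The value of the beta integral `∫₀¹ sᵇ (1 - s)^α ds`. -/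
noncomputable def betaNat (α : ℝ) (b : ℕ) : ℝ :=
  b.factorial / ∏ j ∈ Finset.range (b + 1), (α + 1 + j)

theorem integral_pow_mul_sub_rpow {T α : ℝ} (hT : 0 < T) (hα : 0 ≤ α) (b : ℕ) :
    ∫ s in (0 : ℝ)..T, s ^ b * (T - s) ^ α = T ^ (α + b + 1) * betaNat α b := by
  have h1 := Complex.betaIntegral_scaled (b + 1) (α + 1) hT
  rw [← Complex.betaIntegral_symm, Complex.betaIntegral_eval_nat_add_one_right (by
    simp; positivity)] at h1
  have h2 : ∫ s in (0 : ℝ)..T, (s : ℂ) ^ ((b : ℂ) + 1 - 1) * ((T : ℂ) - s) ^ ((α : ℂ) + 1 - 1)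
      = ((∫ s in (0 : ℝ)..T, s ^ b * (T - s) ^ α : ℝ) : ℂ) := by
    rw [← intervalIntegral.integral_ofReal]
    refine intervalIntegral.integral_congr fun s hs => ?_
    rw [Set.uIcc_of_le hT.le] at hs
    simp only [add_sub_cancel_right, Complex.cpow_natCast]
    rw [← Complex.ofReal_sub, ← Complex.ofReal_cpow (sub_nonneg.2 hs.2)]
    push_cast
    rfl
  rw [h2] at h1
  have h3 : (T : ℂ) ^ ((b : ℂ) + 1 + (α + 1) - 1) = ((T ^ (α + b + 1) : ℝ) : ℂ) := by
    rw [Complex.ofReal_cpow hT.le]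
    congr 1
    push_cast
    ring
  rw [h3] at h1
  rw [betaNat]
  exact_mod_cast h1

theorem lintegral_pow_mul_sub_rpow {T α : ℝ} (hT : 0 < T) (hα : 0 ≤ α) (b : ℕ) :
    ∫⁻ s in Set.Ioo 0 T, ENNReal.ofReal (s ^ b * (T - s) ^ α)
      = ENNReal.ofReal (T ^ (α + b + 1) * betaNat α b) := by
  rw [← integral_pow_mul_sub_rpow hT hα, intervalIntegral.integral_of_le hT.le,
    integral_Ioc_eq_integral_Ioo, ofReal_integral_eq_lintegral_ofReal]
  · have hc : Continuous fun s : ℝ => s ^ b * (T - s) ^ α :=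
      (continuous_pow b).mul ((continuous_const.sub continuous_id).rpow_const fun _ => Or.inr hα)
    exact hc.integrableOn_Icc.mono_set Set.Ioo_subset_Icc_self
  · refine ae_restrict_of_forall_mem measurableSet_Ioo fun s hs => ?_
    exact mul_nonneg (pow_nonneg hs.1.le _) (Real.rpow_nonneg (sub_nonneg.2 hs.2.le) _)

theorem lintegral_pow {ρ : ℝ} (hρ : 0 < ρ) (a : ℕ) :
    ∫⁻ r in Set.Ioo 0 ρ, ENNReal.ofReal (r ^ a) = ENNReal.ofReal (ρ ^ (a + 1) / (a + 1)) := by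
  have h : ∫ r in (0 : ℝ)..ρ, r ^ a = ρ ^ (a + 1) / (a + 1) := by simp
  rw [← h, intervalIntegral.integral_of_le hρ.le,
    integral_Ioc_eq_integral_Ioo, ofReal_integral_eq_lintegral_ofReal]
  · exact (continuous_pow a).integrableOn_Icc.mono_set Set.Ioo_subset_Icc_self
  · exact ae_restrict_of_forall_mem measurableSet_Ioo fun s hs => pow_nonneg hs.1.le _

theorem betaNat_pos {α : ℝ} (hα : 0 ≤ α) (b : ℕ) : 0 < betaNat α b :=
  div_pos (by positivity) (Finset.prod_pos fun j _ => by positivity)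

theorem setLIntegral_Ioi_eq_of_lt {f φ : ℝ → ENNReal} {ρ : ℝ}
    (h : ∀ x, 0 < x → f x = if x < ρ then φ x else 0) :
    ∫⁻ x in Set.Ioi 0, f x = ∫⁻ x in Set.Ioo 0 ρ, φ x := by
  have h1 : ∫⁻ x in Set.Ioi 0, f x = ∫⁻ x in Set.Ioi 0, (Set.Iio ρ).indicator φ x :=
    setLIntegral_congr_fun measurableSet_Ioi fun x hx => by
      rw [h x hx, Set.indicator_apply]
      rfl
  rw [h1, setLIntegral_indicator measurableSet_Iio, Set.inter_comm, Set.Ioi_inter_Iio]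

/-- The domain in the variables `|zᵢ|²`, sliced so that each upper limit depends only on the
variables further out. -/
theorem rpow_add_rpow_lt_one_iff (hp : 0 < p) (hlam : 0 < lam) {r s t : ℝ} (hr : 0 < r)
    (hs : 0 < s) : (r ^ p + s) ^ (1 / lam) + t < 1 ↔
      t < 1 ∧ s < (1 - t) ^ lam ∧ r < ((1 - t) ^ lam - s) ^ (1 / p) := by
  have hX : 0 < r ^ p + s := by positivity
  rw [← lt_sub_iff_add_lt]
  have h1 : 0 < (r ^ p + s) ^ (1 / lam) := by positivity
  rcases lt_or_ge t 1 with ht | ht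
  · rw [one_div, Real.rpow_inv_lt_iff_of_pos hX.le (by linarith) hlam]
    rcases lt_or_ge s ((1 - t) ^ lam) with h | h
    · rw [one_div, Real.lt_rpow_inv_iff_of_pos hr.le (by linarith) hp]
      simp only [ht, h, true_and]
      constructor <;> intro _ <;> linarith
    · have : 0 < r ^ p := by positivity
      simp only [not_lt.2 h, false_and, and_false, iff_false, not_lt]
      linarith
  · simp only [not_lt.2 ht, false_and, iff_false, not_lt]
    linarith

/-- The squared norms of the monomials in the Bergman space of `E_{p,λ}`. -/
theorem monomialNormSq_domainE (hp : 0 < p) (hlam : 0 < lam) (m : Fin 3 → ℕ) :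
    monomialNormSq (domainE p lam) m = Real.pi ^ 3 / (m 0 + 1) *
      betaNat ((m 0 + 1) / p) (m 1) * betaNat (lam * ((m 0 + 1) / p + m 1 + 1)) (m 2) := by
  have hΩ := isBoundedReinhardt_domainE hp hlam
  -- The exponent left by the `r`-integral: the upper limit is a `1/p`-th power and is raised to `m
  -- 0 + 1`.
  set α : ℝ := (m 0 + 1) / p with hα
  have hα0 : 0 ≤ α := by positivity
  have hB := betaNat_pos hα0 (m 1)
  have hB' := betaNat_pos (by positivity : 0 ≤ lam * (α + m 1 + 1)) (m 2)
  set D : Set (Fin 3 → ℝ) := {r | (r 0 ^ p + r 1) ^ (1 / lam) + r 2 < 1} with hD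
  have hDm : MeasurableSet D := measurableSet_lt (by fun_prop) (by fun_prop)
  have hmem : ∀ w : Fin 3 → ℂ, w ∈ domainE p lam ↔ normSqs w ∈ D := by
    intro w
    simp only [domainE, hD, Set.mem_ofPred_eq, normSqs, Complex.normSq_eq_norm_sq,
      ← Real.rpow_natCast_mul (norm_nonneg _), Nat.cast_ofNat]
  have hcm : Measurable fun r : Fin 3 → ℝ => mpow r m := by
    unfold mpow
    fun_prop
  set g : (Fin 3 → ℝ) → ENNReal := D.indicator fun r => ENNReal.ofReal (mpow r m) with hg
  have hgm : Measurable g := hcm.ennreal_ofReal.indicator hDm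
  have h1 : ENNReal.ofReal (monomialNormSq (domainE p lam) m) = ∫⁻ w, g (normSqs w) := by
    rw [monomialNormSq, ofReal_integral_eq_lintegral_ofReal
      ((hΩ.memLp_mpow m).integrable_norm_pow (by norm_num))
      (Filter.Eventually.of_forall fun w => sq_nonneg _),
      ← lintegral_indicator hΩ.isOpen.measurableSet]
    refine lintegral_congr fun w => ?_
    by_cases hw : w ∈ domainE p lam
    · rw [hg, Set.indicator_of_mem hw, Set.indicator_of_mem ((hmem w).1 hw)]
      congr 1
      rw [norm_mpow, mpow, mpow, ← Finset.prod_pow]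
      refine Finset.prod_congr rfl fun i _ => ?_
      rw [pow_right_comm, normSqs, Complex.normSq_eq_norm_sq]
    · rw [hg, Set.indicator_of_notMem hw, Set.indicator_of_notMem fun h => hw ((hmem w).2 h)]
  have hgv : ∀ r s t : ℝ, 0 < r → 0 < s → g ![r, s, t] =
      if t < 1 ∧ s < (1 - t) ^ lam ∧ r < ((1 - t) ^ lam - s) ^ (1 / p) then
        ENNReal.ofReal (r ^ m 0 * s ^ m 1 * t ^ m 2) else 0 := by
    intro r s t hr hs
    simp only [hg, Set.indicator_apply, hD, Set.mem_ofPred_eq, Matrix.cons_val,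
      rpow_add_rpow_lt_one_iff hp hlam hr hs, mpow, Fin.prod_univ_three]
  have k1 : ∀ s t : ℝ, 0 < s → 0 < t → ∫⁻ r in Set.Ioi 0, g ![r, s, t] =
      if t < 1 ∧ s < (1 - t) ^ lam then ENNReal.ofReal (t ^ m 2 / (m 0 + 1)) *
        ENNReal.ofReal (s ^ m 1 * ((1 - t) ^ lam - s) ^ α) else 0 := by
    intro s t hs ht
    split_ifs with h
    · have h3 : 0 < (1 - t) ^ lam - s := sub_pos.2 h.2
      rw [setLIntegral_Ioi_eq_of_lt (ρ := ((1 - t) ^ lam - s) ^ (1 / p))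
        (φ := fun r => ENNReal.ofReal (s ^ m 1 * t ^ m 2) * ENNReal.ofReal (r ^ m 0))]
      · rw [lintegral_const_mul' _ _ ENNReal.ofReal_ne_top, lintegral_pow (by positivity),
          ← ENNReal.ofReal_mul (by positivity), ← ENNReal.ofReal_mul (by positivity)]
        congr 1
        have : (((1 - t) ^ lam - s) ^ (1 / p)) ^ (m 0 + 1) = ((1 - t) ^ lam - s) ^ α := by
          rw [← Real.rpow_natCast, ← Real.rpow_mul h3.le, hα]
          push_cast
          ring_nf
        rw [this]
        ring
      · intro r hr
        rw [hgv r s t hr hs]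
        simp only [h.1, h.2, true_and]
        split_ifs
        · rw [← ENNReal.ofReal_mul (by positivity)]
          congr 1
          ring
        · rfl
    · rw [setLIntegral_congr_fun (g := fun _ => 0) measurableSet_Ioi fun r hr => ?_]
      · simp
      · rw [hgv r s t hr hs, if_neg fun h' => h ⟨h'.1, h'.2.1⟩]
  -- With `T = (1 - t) ^ λ`, the beta integral over `s < T` scales as `T ^ (α + m₁ + 1)`; this is
  -- the exponent of `1 - t` in the last integral.
  have k2 : ∀ t : ℝ, 0 < t → ∫⁻ s in Set.Ioi 0, ∫⁻ r in Set.Ioi 0, g ![r, s, t] =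
      if t < 1 then ENNReal.ofReal (betaNat α (m 1) / (m 0 + 1)) *
        ENNReal.ofReal (t ^ m 2 * (1 - t) ^ (lam * (α + m 1 + 1))) else 0 := by
    intro t ht
    split_ifs with h
    · have h3 : 0 < 1 - t := sub_pos.2 h
      rw [setLIntegral_Ioi_eq_of_lt (ρ := (1 - t) ^ lam)
        (φ := fun s => ENNReal.ofReal (t ^ m 2 / (m 0 + 1)) *
        ENNReal.ofReal (s ^ m 1 * ((1 - t) ^ lam - s) ^ α))]
      · rw [lintegral_const_mul' _ _ ENNReal.ofReal_ne_top,
          lintegral_pow_mul_sub_rpow (by positivity) hα0, ← Real.rpow_mul h3.le,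
          ← ENNReal.ofReal_mul (by positivity), ← ENNReal.ofReal_mul (by positivity)]
        congr 1
        ring
      · intro s hs
        rw [k1 s t hs ht]
        simp only [h, true_and]
    · rw [setLIntegral_congr_fun (g := fun _ => 0) measurableSet_Ioi fun s hs => ?_]
      · simp
      · rw [k1 s t hs ht, if_neg fun h' => h h'.1]
  have k3 : ∫⁻ t in Set.Ioi 0, ∫⁻ s in Set.Ioi 0, ∫⁻ r in Set.Ioi 0, g ![r, s, t] =
      ENNReal.ofReal (betaNat α (m 1) / (m 0 + 1)) *
        ENNReal.ofReal (betaNat (lam * (α + m 1 + 1)) (m 2)) := by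
    rw [setLIntegral_Ioi_eq_of_lt k2, lintegral_const_mul' _ _ ENNReal.ofReal_ne_top,
      lintegral_pow_mul_sub_rpow one_pos (by positivity), Real.one_rpow, one_mul]
  rw [lintegral_comp_normSqs hgm, k3, ← ENNReal.ofReal_mul (by positivity),
    ← ENNReal.ofReal_mul (by positivity),
    ENNReal.ofReal_eq_ofReal_iff (hΩ.monomialNormSq_pos m).le (by positivity)] at h1
  rw [h1]
  ring

end DomainE

/-! ### The unit ball -/

section UnitBall

/-- The free exponent `d` makes the induction close: fixing the first index at `k`, the sum over the
others is the same statement with `d` replaced by `k + d`, and the sum over `k` is a negative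
binomial series. -/
theorem hasSum_multinomial : ∀ {n : ℕ} (d : ℕ) {r : Fin n → ℝ}, (∀ i, 0 ≤ r i) → ∑ i, r i < 1 →
    HasSum (fun m : Fin n → ℕ => ((∑ i, m i + d).factorial : ℝ) /
      (d.factorial * ∏ i, (m i).factorial) * mpow r m) (((1 - ∑ i, r i) ^ (d + 1))⁻¹)
  | 0, d, r, _, _ => by
    have hd : (d.factorial : ℝ) ≠ 0 := by positivity
    simp [mpow, hd]
  | n + 1, d, r, hr, h => by
    rw [Fin.sum_univ_succ] at h
    set s := ∑ i : Fin n, r i.succ with hs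
    have hs0 : 0 ≤ s := Finset.sum_nonneg fun i _ => hr _
    have hs1 : 0 < 1 - s := by linarith [hr 0]
    have hfib : ∀ k : ℕ, HasSum (fun m : Fin n → ℕ =>
        ((∑ i, (Fin.cons k m : Fin (n + 1) → ℕ) i + d).factorial : ℝ) /
          (d.factorial * ∏ i, ((Fin.cons k m : Fin (n + 1) → ℕ) i).factorial) *
            mpow r (Fin.cons k m : Fin (n + 1) → ℕ))
        (((1 - s) ^ (d + 1))⁻¹ * (((k + d).choose d : ℝ) * (r 0 / (1 - s)) ^ k)) := by
      intro k
      have h1 := (hasSum_multinomial (k + d) (fun i => hr i.succ)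
        (by linarith [hr 0] : ∑ i : Fin n, r i.succ < 1)).mul_left
          (((k + d).factorial : ℝ) / (k.factorial * d.factorial) * r 0 ^ k)
      convert! h1 using 1
      · ext m
        simp only [Fin.sum_univ_succ, Fin.prod_univ_succ, Fin.cons_zero, Fin.cons_succ, mpow_cons,
          Nat.cast_mul]
        rw [show k + ∑ i, m i + d = ∑ i, m i + (k + d) by ring]
        have : (∏ i, ((m i).factorial : ℝ)) ≠ 0 :=
          Finset.prod_ne_zero_iff.2 fun i _ => by positivity
        push_cast
        field_simp
      · rw [add_comm k d, Nat.cast_add_choose ℝ, ← hs, add_comm d k, pow_add, pow_add, div_pow]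
        field_simp
        ring
    have hq : ‖r 0 / (1 - s)‖ < 1 := by
      rw [Real.norm_of_nonneg (div_nonneg (hr 0) hs1.le), div_lt_one hs1]
      linarith
    have hout := (hasSum_choose_mul_geometric_of_norm_lt_one d hq).mul_left (((1 - s) ^ (d + 1))⁻¹)
    rw [← (Fin.consEquiv fun _ : Fin (n + 1) => ℕ).hasSum_iff]
    -- Nonnegativity turns summability of the iterated sums into summability over all multi-indices.
    have hnn : 0 ≤ (fun m : Fin (n + 1) → ℕ => ((∑ i, m i + d).factorial : ℝ) /
        (d.factorial * ∏ i, (m i).factorial) * mpow r m) ∘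
          (Fin.consEquiv fun _ : Fin (n + 1) => ℕ) := fun q =>
      mul_nonneg (by positivity) (mpow_nonneg hr _)
    have hsum := (summable_prod_of_nonneg hnn).2 ⟨fun k => (hfib k).summable, by
      refine hout.summable.congr fun k => ?_
      exact (hfib k).tsum_eq.symm⟩
    rw [hsum.hasSum_iff, hsum.tsum_prod' fun k => (hfib k).summable]
    refine (tsum_congr fun k => (hfib k).tsum_eq).trans (hout.tsum_eq.trans ?_)
    have e : 1 - ∑ i, r i = (1 - s) * (1 - r 0 / (1 - s)) := by
      rw [Fin.sum_univ_succ, ← hs]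
      field_simp
      ring
    rw [e, mul_pow, mul_inv, one_div]

theorem betaNat_natCast (a b : ℕ) :
    betaNat a b = b.factorial * a.factorial / (a + b + 1).factorial := by
  have h : (∏ j ∈ Finset.range (b + 1), ((a : ℝ) + 1 + j)) = (a + 1).ascFactorial (b + 1) := by
    rw [Nat.ascFactorial_eq_prod_range]
    push_cast
    rfl
  have h2 := Nat.factorial_mul_ascFactorial a (b + 1)
  have h3 : ((a + b + 1).factorial : ℝ) = a.factorial * (a + 1).ascFactorial (b + 1) := by
    exact_mod_cast h2.symm
  have h4 : ((a + 1).ascFactorial (b + 1) : ℝ) ≠ 0 := by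
    exact_mod_cast (Nat.ascFactorial_pos a (b + 1)).ne'
  rw [betaNat, h, h3]
  field_simp

theorem domainE_one_one : domainE 1 1 = unitBall 3 := by
  ext v
  simp [domainE, unitBall, normSqs, Fin.sum_univ_three, Complex.normSq_eq_norm_sq]

theorem monomialNormSq_domainE_one_one (m : Fin 3 → ℕ) : (monomialNormSq (domainE 1 1) m)⁻¹
    = (Real.pi ^ 3)⁻¹ * 6 * (((∑ i, m i + 3).factorial : ℝ) /
      ((3).factorial * ∏ i, (m i).factorial)) := by
  rw [monomialNormSq_domainE one_pos one_pos]
  have e1 : ((m 0 : ℝ) + 1) / 1 = ((m 0 + 1 : ℕ) : ℝ) := by simp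
  have e2 : 1 * (((m 0 : ℝ) + 1) / 1 + m 1 + 1) = ((m 0 + m 1 + 2 : ℕ) : ℝ) := by
    push_cast
    ring
  rw [e2, e1, betaNat_natCast, betaNat_natCast, Fin.sum_univ_three, Fin.prod_univ_three,
    show m 0 + 1 + m 1 + 1 = m 0 + m 1 + 2 by ring,
    show m 0 + m 1 + 2 + m 2 + 1 = m 0 + m 1 + m 2 + 3 by ring, Nat.factorial_succ (m 0)]
  have : ((3).factorial : ℝ) = 6 := by norm_num [Nat.factorial]
  rw [this]
  push_cast
  field_simp

end UnitBall

/-! ### The Bergman metric in terms of the power series of the kernel -/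

section Main

/-- The coefficients of the Bergman kernel of a Reinhardt domain. -/
noncomputable def kernelCoeff {n : ℕ} (Ω : Set (Fin n → ℂ)) (m : Fin n → ℕ) : ℝ :=
  (monomialNormSq Ω m)⁻¹

theorem IsBoundedReinhardt.bergmanMetric_apply {n : ℕ} {Ω : Set (Fin n → ℂ)}
    (hΩ : IsBoundedReinhardt Ω) {z : Fin n → ℂ} (hz : z ∈ Ω) (i j : Fin n) :
    bergmanMetric Ω z i j = wirtinger i (wirtingerBar j fun w =>
      (Real.log (mseries (kernelCoeff Ω) (normSqs w)) : ℂ)) z := by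
  refine wirtinger_congr i ?_
  filter_upwards [hΩ.isOpen.mem_nhds hz] with w hw
  refine wirtingerBar_congr j ?_
  filter_upwards [hΩ.isOpen.mem_nhds hw] with v hv
  rw [hΩ.bergmanKernel_self hv, Complex.ofReal_re]
  rfl

theorem log_kernel_unitBall {z : Fin 3 → ℂ} (hz : z ∈ unitBall 3) :
    Real.log (mseries (kernelCoeff (domainE 1 1)) (normSqs z))
      = Real.log ((Real.pi ^ 3)⁻¹ * 6) - 4 * Real.log (1 - ∑ i, normSqs z i) := by
  have hpos : 0 < 1 - ∑ i, normSqs z i := sub_pos.2 hz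
  have h := (hasSum_multinomial 3 (r := normSqs z) (fun i => Complex.normSq_nonneg _) hz).mul_left
    ((Real.pi ^ 3)⁻¹ * 6)
  have e : mseries (kernelCoeff (domainE 1 1)) (normSqs z)
      = (Real.pi ^ 3)⁻¹ * 6 * ((1 - ∑ i, normSqs z i) ^ (3 + 1))⁻¹ := by
    rw [← h.tsum_eq, mseries]
    refine tsum_congr fun m => ?_
    rw [kernelCoeff, monomialNormSq_domainE_one_one]
    ring
  rw [e, Real.log_mul (by positivity) (by positivity), Real.log_inv, Real.log_pow]
  push_cast
  ring

/-- The constant 4 is the exponent of `1 - ‖z‖²` in the kernel of the ball in dimension three. -/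
theorem bergmanMetric_unitBall {z : Fin 3 → ℂ} (hz : z ∈ unitBall 3) :
    bergmanMetric (unitBall 3) z = ballMetric 4 z := by
  have hΩ : IsBoundedReinhardt (unitBall 3) :=
    domainE_one_one ▸ isBoundedReinhardt_domainE one_pos one_pos
  set G : (Fin 3 → ℝ) → ℝ := fun r =>
    Real.log ((Real.pi ^ 3)⁻¹ * 6) - 4 * Real.log (1 - ∑ i, r i) with hG
  have hne := one_sub_ne_zero hz
  have hsub : ∀ r : Fin 3 → ℝ, HasFDerivAt (fun r : Fin 3 → ℝ => 1 - ∑ i, r i)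
      (-∑ i, (ContinuousLinearMap.proj i : (Fin 3 → ℝ) →L[ℝ] ℝ)) r := fun r =>
    (HasFDerivAt.fun_sum fun i _ =>
      (ContinuousLinearMap.proj (R := ℝ) (φ := fun _ : Fin 3 => ℝ) i).hasFDerivAt).const_sub 1
  have hGd : ∀ (j : Fin 3) (r : Fin 3 → ℝ), 1 - ∑ i, r i ≠ 0 →
      partialDeriv j G r = 4 * (1 - ∑ i, r i)⁻¹ := by
    intro j r hr
    rw [partialDeriv, ((((hsub r).log hr).const_mul 4).const_sub _).fderiv]
    simp
  have hcd : ContDiff ℝ 2 fun r : Fin 3 → ℝ => 1 - ∑ i, r i :=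
    contDiff_const.sub (ContDiff.sum fun i _ => contDiff_apply ℝ ℝ i)
  have hG2 : ContDiffAt ℝ 2 G (normSqs z) :=
    contDiffAt_const.sub (contDiffAt_const.mul (hcd.contDiffAt.log hne))
  have hGdd : ∀ i j : Fin 3, partialDeriv i (partialDeriv j G) (normSqs z)
      = 4 * ((1 - ∑ i, normSqs z i)⁻¹) ^ 2 := by
    intro i j
    have hev : partialDeriv j G =ᶠ[nhds (normSqs z)] fun r => 4 * (1 - ∑ i, r i)⁻¹ := by
      filter_upwards [hcd.continuous.continuousAt.eventually_ne hne] with r hr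
      exact hGd j r hr
    rw [partialDeriv, hev.fderiv_eq, ((hasFDerivAt_inv_one_sub_sum hne).const_mul 4).fderiv]
    simp
  ext i j
  have hev : (wirtingerBar j fun w =>
      (Real.log (mseries (kernelCoeff (unitBall 3)) (normSqs w)) : ℂ)) =ᶠ[nhds z]
        wirtingerBar j fun w => (G (normSqs w) : ℂ) := by
    filter_upwards [hΩ.isOpen.mem_nhds hz] with w hw
    refine wirtingerBar_congr j ?_
    filter_upwards [hΩ.isOpen.mem_nhds hw] with v hv
    rw [← domainE_one_one, log_kernel_unitBall hv]
  rw [hΩ.bergmanMetric_apply hz, wirtinger_congr i hev,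
    wirtinger_wirtingerBar_comp_normSqs hG2, hGd j _ hne, hGdd]
  simp only [ballMetric, Matrix.of_apply, ballWeight]
  push_cast
  ring

theorem isKahlerEinstein_unitBall :
    IsKahlerEinstein (unitBall 3) (bergmanMetric (unitBall 3)) :=
  (isKahlerEinstein_ballMetric (by norm_num : (0 : ℝ) < 4)).congr isOpen_unitBall
    fun _ hz => (bergmanMetric_unitBall hz).symm

/-! ### The Einstein equation at the origin in terms of kernel coefficients -/

section Origin

variable {n : ℕ} {Ω : Set (Fin n → ℂ)}

theorem IsBoundedReinhardt.kernelCoeff_pos (hΩ : IsBoundedReinhardt Ω) (m : Fin n → ℕ) :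
    0 < kernelCoeff Ω m := inv_pos.2 (hΩ.monomialNormSq_pos m)

theorem GeomBounded.contDiffAt_log_mseries {a : (Fin n → ℕ) → ℝ} (ha : GeomBounded a)
    (h0 : 0 < a 0) (k : ℕ) : ContDiffAt ℝ k (fun r => Real.log (mseries a r)) 0 :=
  (ha.contDiffAt_mseries k).log (by rw [mseries_zero]; exact h0.ne')

theorem GeomBounded.partialDeriv_log_mseries {a : (Fin n → ℕ) → ℝ} (ha : GeomBounded a)
    (h0 : 0 < a 0) (j : Fin n) : partialDeriv j (fun r => Real.log (mseries a r))
      =ᶠ[nhds 0] fun r => mseries (_root_.mderiv j a) r / mseries a r := by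
  have hc : ContinuousAt (mseries a) 0 := (ha.contDiffAt_mseries 0).continuousAt
  filter_upwards [ha.hasFDerivAt_mseries, ha.partialDeriv_mseries j,
    hc.eventually_ne (by rw [mseries_zero]; exact h0.ne')] with r hr hp hne
  rw [partialDeriv, (hr.log hne).fderiv, ← hp, partialDeriv, hr.fderiv]
  simp
  ring

theorem GeomBounded.partialDeriv_log_mseries_zero {a : (Fin n → ℕ) → ℝ} (ha : GeomBounded a)
    (h0 : 0 < a 0) (j : Fin n) : partialDeriv j (fun r => Real.log (mseries a r)) 0
      = a (Pi.single j 1) / a 0 := by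
  rw [(ha.partialDeriv_log_mseries h0 j).eq_of_nhds, mseries_zero, mseries_zero, _root_.mderiv]
  simp

/-- The quotient rule for `S_j / S`; the factor 2 when `i = j` comes from differentiating a square
twice. -/
theorem GeomBounded.partialDeriv_partialDeriv_log_mseries_zero {a : (Fin n → ℕ) → ℝ}
    (ha : GeomBounded a) (h0 : 0 < a 0) (i j : Fin n) :
    partialDeriv i (partialDeriv j fun r => Real.log (mseries a r)) 0
      = (1 + if i = j then 1 else 0) * a (Pi.single i 1 + Pi.single j 1) / a 0
        - a (Pi.single i 1) / a 0 * (a (Pi.single j 1) / a 0) := by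
  have hS := ha.hasFDerivAt_mseries.self_of_nhds
  have hSj := (ha.mderiv j).hasFDerivAt_mseries.self_of_nhds
  have hne : mseries a 0 ≠ 0 := by rw [mseries_zero]; exact h0.ne'
  have hq := hSj.fun_mul ((hasDerivAt_inv hne).comp_hasFDerivAt 0 hS)
  have hev : partialDeriv j (fun r => Real.log (mseries a r)) =ᶠ[nhds 0]
      fun r => mseries (_root_.mderiv j a) r * (Inv.inv ∘ mseries a) r :=
    (ha.partialDeriv_log_mseries h0 j).trans
      (Filter.Eventually.of_forall fun r => div_eq_mul_inv _ _)
  rw [partialDeriv, hev.fderiv_eq, hq.fderiv]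
  simp [Pi.single_apply, mseries_zero, _root_.mderiv]
  field_simp
  rcases eq_or_ne i j with rfl | hij
  · simp
    ring
  · simp [hij, hij.symm]
    ring

/-- The Einstein equation at the origin in terms of the coefficients of the Bergman kernel. -/
theorem IsBoundedReinhardt.einstein_zero (hΩ : IsBoundedReinhardt Ω) {c : ℝ}
    (h : ricciCurvature (bergmanMetric Ω) 0 = (c : ℂ) • bergmanMetric Ω 0) {l : Fin n → ℝ}
    (hl : ∀ i, l i = kernelCoeff Ω (Pi.single i 1) / kernelCoeff Ω 0) (k : Fin n) :
    -∑ i, (1 + if i = k then 1 else 0) *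
      ((1 + if k = i then 1 else 0) * kernelCoeff Ω (Pi.single k 1 + Pi.single i 1) /
        kernelCoeff Ω 0 - l k * l i) / l i = c * l k := by
  have h0 := hΩ.kernelCoeff_pos 0
  have hg : GeomBounded (kernelCoeff Ω) := hΩ.geomBounded
  have hL : ContDiffAt ℝ 4 (fun r => Real.log (mseries (kernelCoeff Ω) r)) 0 := by
    exact_mod_cast hg.contDiffAt_log_mseries h0 4
  have hM : ∀ i j, (fun z => bergmanMetric Ω z i j) =ᶠ[nhds 0] wirtinger i (wirtingerBar j
      fun w => (Real.log (mseries (kernelCoeff Ω) (normSqs w)) : ℂ)) := fun i j => by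
    filter_upwards [hΩ.isOpen.mem_nhds hΩ.zero_mem] with z hz
    exact hΩ.bergmanMetric_apply hz i j
  have hl' : ∀ i, partialDeriv i (fun r => Real.log (mseries (kernelCoeff Ω) r)) 0 = l i :=
    fun i => by rw [hg.partialDeriv_log_mseries_zero h0, hl]
  have hpos : ∀ i, l i ≠ 0 := fun i => by
    rw [hl]
    exact (div_pos (hΩ.kernelCoeff_pos _) h0).ne'
  have h1 := ricciCurvature_zero hL hM (fun i => by rw [hl']; exact hpos i) k
  rw [h, Matrix.smul_apply, metric_zero_eq_diagonal hL hM, Matrix.diagonal_apply_eq, hl',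
    smul_eq_mul, ← Complex.ofReal_mul, Complex.ofReal_inj] at h1
  rw [h1]
  congr 1
  refine Finset.sum_congr rfl fun i _ => ?_
  rw [hg.partialDeriv_partialDeriv_log_mseries_zero h0, hl', hl, hl]

end Origin

end Main

/-! ### Low-degree kernel coefficients and the resulting equation in `q` and `λ` -/

theorem betaNat_zero (α : ℝ) : betaNat α 0 = 1 / (α + 1) := by
  simp [betaNat]

theorem betaNat_one (α : ℝ) : betaNat α 1 = 1 / ((α + 1) * (α + 2)) := by
  norm_num [betaNat, Finset.prod_range_succ, add_assoc]

theorem betaNat_two (α : ℝ) : betaNat α 2 = 2 / ((α + 1) * (α + 2) * (α + 3)) := by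
  norm_num [betaNat, Finset.prod_range_succ, add_assoc]

section KernelRatio

variable {p lam q : ℝ}

theorem kernelCoeff_domainE_div (hp : 0 < p) (hlam : 0 < lam) (hq : 1 / p = q)
    (m : Fin 3 → ℕ) :
    kernelCoeff (domainE p lam) m / kernelCoeff (domainE p lam) 0 =
      (m 0 + 1) / ((q + 1) * (lam * (q + 1) + 1) *
        (betaNat ((m 0 + 1) * q) (m 1) * betaNat (lam * ((m 0 + 1) * q + m 1 + 1)) (m 2))) := by
  have hq0 : 0 < q := hq ▸ one_div_pos.2 hp
  have e : ∀ a : ℕ, ((a : ℝ) + 1) / p = (a + 1) * q := fun a => by rw [← hq]; ring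
  have h1 := betaNat_pos (by positivity : 0 ≤ ((m 0 : ℝ) + 1) * q) (m 1)
  have h2 := betaNat_pos (by positivity : 0 ≤ lam * (((m 0 : ℝ) + 1) * q + m 1 + 1)) (m 2)
  simp only [kernelCoeff, monomialNormSq_domainE hp hlam, e]
  simp only [Pi.zero_apply, betaNat_zero]
  push_cast
  simp only [zero_add, add_zero, one_mul]
  field_simp

/-- At the origin, the `z`-component of the Einstein equation determines the constant and the
`x`-component is then the following equation in `q = 1 / p` and `λ`. -/
theorem einstein_domainE (hp : 0 < p) (hlam : 0 < lam) (hq : 1 / p = q) {c : ℝ}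
    (h : ricciCurvature (bergmanMetric (domainE p lam)) 0 =
      (c : ℂ) • bergmanMetric (domainE p lam) 0) :
    6 * (3 * q + 1) * (lam * (3 * q + 1) + 1) / ((2 * q + 1) * (lam * (2 * q + 1) + 1)) +
      4 * (2 * q + 1) * (lam * (2 * q + 2) + 1) / ((q + 2) * (lam * (q + 2) + 1)) -
      2 * (2 * q + 1) * (lam * (2 * q + 1) + 1) / ((q + 1) * (lam * (q + 1) + 1)) *
        (4 - lam * q / (lam * (q + 1) + 2)) = 0 := by
  have hq0 : 0 < q := hq ▸ one_div_pos.2 hp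
  have R := kernelCoeff_domainE_div hp hlam hq
  have H := (isBoundedReinhardt_domainE hp hlam).einstein_zero h (l := fun i =>
    kernelCoeff (domainE p lam) (Pi.single i 1) / kernelCoeff (domainE p lam) 0) fun _ => rfl
  simp only [mul_div_assoc, R] at H
  have hz := H 2
  have hx := H 0
  simp [Fin.sum_univ_three, Pi.single_apply, betaNat_zero, betaNat_one, betaNat_two] at hz hx
  -- The `x`, `y` and `z` terms of the sum are `λq`, `λ` and `2`. Their total `λ(q + 1) + 2` is also
  -- the metric entry multiplying `c`, whatever the parameters.
  have hc : c = -1 := by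
    field_simp at hz
    have hA : 0 < lam * (q + 1) + 2 := by positivity
    refine mul_right_cancel₀ hA.ne' ?_
    linear_combination (-1 / 2) * hz
  rw [hc] at hx
  refine Eq.trans ?_ (sub_eq_zero.2 hx.symm)
  field_simp
  ring

end KernelRatio

/-- The only positive solution of the equation is `q = λ = 1`. -/
theorem eq_one_of_einstein {q l : ℝ} (hq : 0 < q) (hl : 0 < l)
    (h : 6 * (3 * q + 1) * (l * (3 * q + 1) + 1) / ((2 * q + 1) * (l * (2 * q + 1) + 1)) +
      4 * (2 * q + 1) * (l * (2 * q + 2) + 1) / ((q + 2) * (l * (q + 2) + 1)) -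
      2 * (2 * q + 1) * (l * (2 * q + 1) + 1) / ((q + 1) * (l * (q + 1) + 1)) *
        (4 - l * q / (l * (q + 1) + 2)) = 0) : q = 1 ∧ l = 1 := by
  have key : (31/66 * (l * (1 - q) ^ 2) +
        11/3 * (q ^ 2 * l ^ 2 * (q - l) ^ 2) +
        254/33 * (q * l ^ 2 * (1 - l) ^ 2) +
        2 * ((1 - q) ^ 2) +
        97/33 * (q * l * (1 - q) ^ 2) +
        97/22 * (l * (q - l) ^ 2) +
        13/3 * (q ^ 2 * l ^ 4 * (1 - q ^ 2) ^ 2) +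
        28 * (q * l ^ 2 * (1 - q ^ 2 * l) ^ 2) +
        398/33 * (q * l * (q - l) ^ 2) +
        307/66 * (q ^ 2 * l ^ 2 * (1 - q) ^ 2) +
        76/3 * (q * l ^ 3 * (1 - q ^ 2) ^ 2) +
        142/33 * (q * l ^ 2 * (q - l) ^ 2) +
        4 * (l ^ 2 * (q ^ 2 - l) ^ 2) +
        281/33 * (l ^ 2 * (1 - q ^ 2) ^ 2) +
        3 * (q * l ^ 4 * (1 - q ^ 2) ^ 2) +
        13/6 * (q ^ 4 * l ^ 2 * (1 - q * l) ^ 2) +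
        189/22 * (l * (1 - l) ^ 2) +
        80/3 * (l ^ 2 * (1 - q ^ 2 * l) ^ 2) +
        64/33 * (l * (1 - q * l) ^ 2) +
        9/2 * (q ^ 2 * l ^ 2 * (1 - q ^ 2 * l) ^ 2)) = 0 := by
    -- The cleared numerator equals `2q` times the displayed combination. Every square in it
    -- vanishes at `q = l = 1`, and every weight is a positive coefficient times a monomial in `q`
    -- and `l`.
    field_simp at h
    have h2 : (2 * q) * (31/66 * (l * (1 - q) ^ 2) +
        11/3 * (q ^ 2 * l ^ 2 * (q - l) ^ 2) +
        254/33 * (q * l ^ 2 * (1 - l) ^ 2) +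
        2 * ((1 - q) ^ 2) +
        97/33 * (q * l * (1 - q) ^ 2) +
        97/22 * (l * (q - l) ^ 2) +
        13/3 * (q ^ 2 * l ^ 4 * (1 - q ^ 2) ^ 2) +
        28 * (q * l ^ 2 * (1 - q ^ 2 * l) ^ 2) +
        398/33 * (q * l * (q - l) ^ 2) +
        307/66 * (q ^ 2 * l ^ 2 * (1 - q) ^ 2) +
        76/3 * (q * l ^ 3 * (1 - q ^ 2) ^ 2) +
        142/33 * (q * l ^ 2 * (q - l) ^ 2) +
        4 * (l ^ 2 * (q ^ 2 - l) ^ 2) +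
        281/33 * (l ^ 2 * (1 - q ^ 2) ^ 2) +
        3 * (q * l ^ 4 * (1 - q ^ 2) ^ 2) +
        13/6 * (q ^ 4 * l ^ 2 * (1 - q * l) ^ 2) +
        189/22 * (l * (1 - l) ^ 2) +
        80/3 * (l ^ 2 * (1 - q ^ 2 * l) ^ 2) +
        64/33 * (l * (1 - q * l) ^ 2) +
        9/2 * (q ^ 2 * l ^ 2 * (1 - q ^ 2 * l) ^ 2)) = 0 := by
      linear_combination h
    exact (mul_eq_zero.1 h2).resolve_left (by positivity)
  -- All summands are nonnegative, so a strictly positive one would contradict `key`. Two of them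
  -- suffice: this one determines `q`, and the next determines `l`.
  have hq1 : l * (1 - q) ^ 2 = 0 := by
    refine le_antisymm ?_ (by positivity)
    by_contra! hpos
    exact absurd key (by positivity)
  have hl1 : l * (1 - l) ^ 2 = 0 := by
    refine le_antisymm ?_ (by positivity)
    by_contra! hpos
    exact absurd key (by positivity)
  simp only [mul_eq_zero, hl.ne', false_or, pow_eq_zero_iff two_ne_zero, sub_eq_zero] at hq1 hl1
  exact ⟨hq1.symm, hl1.symm⟩

theorem mainTheorem5 (p lam : ℝ) (hp : 0 < p) (hlam : 0 < lam) :
    IsKahlerEinstein (domainE p lam) (bergmanMetric (domainE p lam)) ↔ lam = 1 ∧ p = 1 := by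
  constructor
  · rintro ⟨_, c, hc⟩
    obtain ⟨h1, h2⟩ := eq_one_of_einstein (one_div_pos.2 hp) hlam <| einstein_domainE hp hlam rfl <|
      hc 0 (isBoundedReinhardt_domainE hp hlam).zero_mem
    exact ⟨h2, by rwa [div_eq_one_iff_eq hp.ne', eq_comm] at h1⟩
  · rintro ⟨rfl, rfl⟩
    rw [domainE_one_one]
    exact isKahlerEinstein_unitBall
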